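/- Consider an episodic multinomial logit MDP with finite state space $\mathcal S$, action space $\mathcal A$, horizon $H$, nonempty reachable sets $\mathcal S_h(s,a)\subseteq\mathcal S$, feature map $\varPhi:\mathcal S\times\mathcal A\to\mathbb R^{|\mathcal S|\times d}$ and parameters $\theta_h^\star\in\mathbb R^d$ ($h\in[H]$) with $\|\varPhi(s,a)^\top \mathbf e_{s'}\|_2\le B_\varPhi$ for all $s,a,s'$ and $\|\theta^\star_h\|_2\le B_\theta$. For $\theta\in\mathbb R^d$ let $$\mathbb P_h(s'\mid s,a,\theta)=\frac{\exp(\mathbf e_{s'}^\top\varPhi(s,a)\theta)}{\sum_{\tilde s\in\mathcal S_h(s,a)}\exp(\mathbf e_{\tilde s}^\top\varPhi(s,a)\theta)}\quad (s'\in\mathcal S_h(s,a)),$$ and $\mathbb P_h(s'\mid s,a,\theta)=0$ for $s'\notin\mathcal S_h(s,a)$. Over $K$ episodes, states $s_{k,1},\dots,s_{k,H+1}$ and actions $a_{k,1},\dots,a_{k,H}$ are generated, where initial states and actions are chosen arbitrarily (possibly at random and depending on the past), and the conditional law of $s_{k,h+1}$ given $\mathcal F_{k,h}$ is $\mathbb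 P_h(\cdot\mid s_{k,h},a_{k,h},\theta_h^\star)$. Here $\mathcal F_{k,h}$ is the $\sigma$-algebra generated by all states (including those at step $H+1$) and actions of the episodes before $k$ and by $s_{k,h'},a_{k,h'}$, $h'\le h$. Let $\ell_{k,h}(\theta):=-\log\mathbb P_h(s_{k,h+1}\mid s_{k,h},a_{k,h},\theta)$, let $\epsilon>0$ and let $\eta\in\mathbb R$ be a learning rate. Put $\theta_{0,h}:=0$ and, for $k\in[K]$, $\tilde\theta_{k,h}:=\theta_{k-1,h}-\eta\,\widehat{\mathbf H}_{k,h}^{-1}\nabla\ell_{k,h}(\theta_{k-1,h})$, where $$\widehat{\mathbf H}_{k,h}:=\sum_{\nu=1}^k\nabla\ell_{\nu,h}(\theta_{\nu-1,h})\nabla\ell_{\nu,h}(\theta_{\nu-1,h})^\top+\epsilon\mathbf I_d .$$ Let the estimates be either the online Newton step estimates, $\theta_{k,h}:=\tilde\theta_{k,h}$ for all $k\in[K]$, or the projected ones, $\theta_{k,h}:=\operatorname{argmin}_{\|\theta\|_2\le B_\theta}(\theta-\tilde\theta_{k,h})^\top\widehat{\mathbf H}_{k,h}(\theta-\tilde\theta_{k,h})$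 for all $k\in[K]$. Define the true (regularized) Hessian $$\mathbf H^\star_{k,h}:=\sum_{\nu=1}^k\nabla^2\ell_{\nu,h}(\theta_h^\star)+B_\varPhi^2\mathbf I_d .$$ Let $\delta\in(0,1)$. For any step $h\in[H]$, if $\epsilon=B_\varPhi^2+4B_\varPhi^2\log(d/\delta)$, then with probability at least $1-\delta$, $$\widehat{\mathbf H}_{k,h}\succeq(1-e^{-1})\,\mathbf H^\star_{k,h}\quad\text{for all }k\in[K].$$ -/

import Mathlib

open MeasureTheory

noncomputable section

/-- The transition model of a multinomial logit MDP with finite state space `S`, action space `A`,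
feature dimension `d` and horizon `H` (steps are numbered `1, …, H`). -/
structure MNLModel (S A : Type*) [Fintype S] [DecidableEq S] [MeasurableSpace A]
    (d H : ℕ) where
  /-- `reach h s a` is the set of states reachable at step `h` from `s` under action `a`. -/
  reach : ℕ → S → A → Finset S
  reach_nonempty : ∀ h s a, (reach h s a).Nonempty
  measurableSet_reach : ∀ h s s', MeasurableSet {a | s' ∈ reach h s a}
  /-- The feature map. -/
  Φ : S → A → Matrix S (Fin d) ℝ
  measurable_Φ : ∀ s s' i, Measurable fun a => Φ s a s' i
  /-- The transition parameters. -/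
  θstar : ℕ → EuclideanSpace ℝ (Fin d)
  /-- The bound for the features. -/
  BΦ : ℝ
  /-- The bound for the parameters. -/
  Bθ : ℝ
  norm_Φ_le : ∀ s a s', ‖WithLp.toLp 2 ((Φ s a).transpose.mulVec (Pi.single s' 1))‖ ≤ BΦ
  norm_θstar_le : ∀ h ∈ Finset.Icc 1 H, ‖θstar h‖ ≤ Bθ

namespace MNLModel

variable {S A : Type*} [Fintype S] [DecidableEq S] [MeasurableSpace A] {d H : ℕ}

/-- The multinomial logit probability, with parameter `θ`, of moving to `s'` from `s` at step `h`
under action `a`. States that are not reachable have probability zero. -/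
def prob (M : MNLModel S A d H) (h : ℕ) (s : S) (a : A) (θ : EuclideanSpace ℝ (Fin d))
    (s' : S) : ℝ :=
  if s' ∈ M.reach h s a then
    Real.exp ((M.Φ s a).mulVec θ.ofLp s') /
      ∑ t ∈ M.reach h s a, Real.exp ((M.Φ s a).mulVec θ.ofLp t)
  else 0

/-- The negative log-likelihood of `θ` for the observed transition `(s, a, s')` at step `h`. -/
def loss (M : MNLModel S A d H) (h : ℕ) (s : S) (a : A) (s' : S)
    (θ : EuclideanSpace ℝ (Fin d)) : ℝ :=
  -Real.log (M.prob h s a θ s')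

end MNLModel

/-- The information available in episode `k` at step `h`, just after the action has been chosen:
all states and actions of the episodes before `k` (with the final states at step `H + 1`), and the
states and actions of episode `k` up to and including step `h`. -/
abbrev history {Ω S A : Type*} [MeasurableSpace S] [MeasurableSpace A] (H : ℕ)
    (s : ℕ → ℕ → Ω → S) (a : ℕ → ℕ → Ω → A) (k h : ℕ) : MeasurableSpace Ω :=
  (⨆ ν ∈ Finset.Ico 1 k, ⨆ h' ∈ Finset.Icc 1 (H + 1), MeasurableSpace.comap (s ν h') inferInstance)
  ⊔ (⨆ ν ∈ Finset.Ico 1 k, ⨆ h' ∈ Finset.Icc 1 H, MeasurableSpace.comap (a ν h') inferInstance)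
  ⊔ (⨆ h' ∈ Finset.Icc 1 h, MeasurableSpace.comap (s k h') inferInstance)
  ⊔ (⨆ h' ∈ Finset.Icc 1 h, MeasurableSpace.comap (a k h') inferInstance)

/-- The random states `s k h` (`1 ≤ k ≤ K`, `1 ≤ h ≤ H + 1`) and actions `a k h`
(`1 ≤ k ≤ K`, `1 ≤ h ≤ H`) are `K` episodes of interaction with the multinomial logit MDP `M`:
given the past, the next state is drawn from the transition probabilities of `M` with the
true parameter. Initial states and actions may depend on the past and on additional randomness in
any way. -/
structure IsInteraction {Ω S A : Type*} [MeasurableSpace Ω] [Fintype S] [DecidableEq S]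
    [MeasurableSpace S] [MeasurableSpace A] {d H : ℕ} (M : MNLModel S A d H) (K : ℕ)
    (s : ℕ → ℕ → Ω → S) (a : ℕ → ℕ → Ω → A) (μ : Measure Ω) : Prop where
  measurable_state : ∀ k ∈ Finset.Icc 1 K, ∀ h ∈ Finset.Icc 1 (H + 1), Measurable (s k h)
  measurable_action : ∀ k ∈ Finset.Icc 1 K, ∀ h ∈ Finset.Icc 1 H, Measurable (a k h)
  transition : ∀ k ∈ Finset.Icc 1 K, ∀ h ∈ Finset.Icc 1 H, ∀ s' : S,
    μ[(s k (h + 1) ⁻¹' {s'}).indicator (fun _ => (1 : ℝ)) | history H s a k h]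
      =ᵐ[μ] fun ω => M.prob h (s k h ω) (a k h ω) (M.θstar h) s'

/-- The negative log-likelihood of the transition observed at step `h` of episode `k`. -/
def episodeLoss {Ω S A : Type*} [Fintype S] [DecidableEq S] [MeasurableSpace A] {d H : ℕ}
    (M : MNLModel S A d H) (s : ℕ → ℕ → Ω → S) (a : ℕ → ℕ → Ω → A) (h : ℕ) (ω : Ω) (k : ℕ) :
    EuclideanSpace ℝ (Fin d) → ℝ :=
  M.loss h (s k h ω) (a k h ω) (s k (h + 1) ω)

/-- The Hessian matrix of `f` at `x`, as the Jacobian matrix of the gradient. -/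
def hessian {d : ℕ} (f : EuclideanSpace ℝ (Fin d) → ℝ) (x : EuclideanSpace ℝ (Fin d)) :
    Matrix (Fin d) (Fin d) ℝ :=
  Matrix.of fun i j => (fderiv ℝ (gradient f) x (EuclideanSpace.single j 1)) i

/-- The observed information matrix `∑_{ν = 1}^k ∇f_ν(θ_{ν-1}) ∇f_ν(θ_{ν-1})ᵀ + ε I` of the losses
`f₁, f₂, …` along the sequence of estimates `θ₀, θ₁, …`. -/
def infoMatrix {d : ℕ} (ε : ℝ) (f : ℕ → EuclideanSpace ℝ (Fin d) → ℝ)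
    (θ : ℕ → EuclideanSpace ℝ (Fin d)) (k : ℕ) : Matrix (Fin d) (Fin d) ℝ :=
  ∑ ν ∈ Finset.Icc 1 k,
      Matrix.vecMulVec (gradient (f ν) (θ (ν - 1))).ofLp (gradient (f ν) (θ (ν - 1))).ofLp
    + ε • (1 : Matrix (Fin d) (Fin d) ℝ)

/-- The true Hessian `∑_{ν = 1}^k ∇²f_ν(θ⋆) + B² I`. -/
def trueHessian {d : ℕ} (B : ℝ) (f : ℕ → EuclideanSpace ℝ (Fin d) → ℝ)
    (θstar : EuclideanSpace ℝ (Fin d)) (k : ℕ) : Matrix (Fin d) (Fin d) ℝ :=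
  ∑ ν ∈ Finset.Icc 1 k, hessian (f ν) θstar + B ^ 2 • (1 : Matrix (Fin d) (Fin d) ℝ)

/-- The Newton step `θ_{k-1} - η Ĥ_k⁻¹ ∇f_k(θ_{k-1})`, for `1 ≤ k`. -/
def newtonStep {d : ℕ} (η ε : ℝ) (f : ℕ → EuclideanSpace ℝ (Fin d) → ℝ)
    (θ : ℕ → EuclideanSpace ℝ (Fin d)) (k : ℕ) : EuclideanSpace ℝ (Fin d) :=
  θ (k - 1) - η • WithLp.toLp 2 ((infoMatrix ε f θ k)⁻¹.mulVec (gradient (f k) (θ (k - 1))).ofLp)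

/-- `θ₀, …, θ_K` are the online Newton step estimates, started at `0`. -/
def IsONS {d : ℕ} (η ε : ℝ) (K : ℕ) (f : ℕ → EuclideanSpace ℝ (Fin d) → ℝ)
    (θ : ℕ → EuclideanSpace ℝ (Fin d)) : Prop :=
  θ 0 = 0 ∧ ∀ k ∈ Finset.Icc 1 K, θ k = newtonStep η ε f θ k

/-- `θ₀, …, θ_K` are the projected online Newton step estimates, started at `0`: each Newton step
is followed by the projection, in the norm of the observed information matrix, onto the ball of
radius `B`. -/
def IsProjectedONS {d : ℕ} (η ε B : ℝ) (K : ℕ) (f : ℕ → EuclideanSpace ℝ (Fin d) → ℝ)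
    (θ : ℕ → EuclideanSpace ℝ (Fin d)) : Prop :=
  θ 0 = 0 ∧ ∀ k ∈ Finset.Icc 1 K, θ k ∈ Metric.closedBall 0 B ∧
    IsMinOn
      (fun x => (x - newtonStep η ε f θ k).ofLp ⬝ᵥ
        (infoMatrix ε f θ k).mulVec (x - newtonStep η ε f θ k).ofLp)
      (Metric.closedBall 0 B) (θ k)

end

/-! The proof is a matrix Chernoff argument in martingale form. Write `c = 1 - e⁻¹` and `B` for the
feature bound. Given the history, the gradient at any parameter `θ` is mean feature under `θ` minus
observed feature. By the bias-variance decomposition, the conditional mean of its outer product is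
the feature covariance under the true parameter plus a rank-one semidefinite term, so it dominates
that covariance, which is the Hessian of the loss. No convergence of the estimates is needed; it is
enough that each gradient is evaluated at a parameter determined by the past.

Gradients have norm at most `2B`, so dividing by `4B²` gives increments `X` with `0 ≤ X ≤ 1`. Let
`Y_k` be the sum of `c` times the normalized covariances minus these increments. Then `tr exp Y_k`
is a supermartingale started at `tr 1 = d`, and the maximal inequality keeps it below `d/δ` for all
`k` at once, with probability at least `1 - δ`. On that event the largest eigenvalue of `Y_k` is at
most `log (d/δ)`; multiplying by `4B²` yields the claim, the `log` part of `ε` absorbing the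
deviation and its `B²` part the regularizer of the true Hessian.

The supermartingale step `sum_trace_exp_le` would usually be drawn from Lieb's concavity theorem.
Here it follows from joint convexity of the quantum relative entropy, `trace_exp_mul_sub_le`, and
the tangent inequality for `tr exp`. Joint convexity is obtained from an integral of quadratic
forms, each a supremum of functions linear in the pair of matrices. -/

/-! ### Functions of symmetric matrices through orthogonal diagonalization -/

section Spectral

variable {n : Type*} [Fintype n] [DecidableEq n]

open Matrix

/-- The matrix with eigenvalues `a` and eigenvectors the columns of the orthogonal matrix `U`. -/
def conjDiag (U : Matrix n n ℝ) (a : n → ℝ) : Matrix n n ℝ := U * diagonal a * Uᵀ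

theorem conjDiag_isHermitian (U : Matrix n n ℝ) (a : n → ℝ) : (conjDiag U a).IsHermitian := by
  simp [Matrix.IsHermitian, conjDiag, Matrix.mul_assoc]

theorem exists_eq_conjDiag {A : Matrix n n ℝ} (hA : A.IsHermitian) :
    ∃ (U : Matrix n n ℝ) (a : n → ℝ), Uᵀ * U = 1 ∧ A = conjDiag U a := by
  refine ⟨hA.eigenvectorUnitary, hA.eigenvalues, ?_, ?_⟩
  · have := Unitary.coe_star_mul_self hA.eigenvectorUnitary
    rwa [star_eq_conjTranspose, conjTranspose_eq_transpose_of_trivial] at this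
  · have := hA.spectral_theorem
    rwa [Unitary.conjStarAlgAut_apply, star_eq_conjTranspose,
      conjTranspose_eq_transpose_of_trivial] at this

theorem conjDiag_one {U : Matrix n n ℝ} (hU : Uᵀ * U = 1) : conjDiag U (fun _ => 1) = 1 := by
  have : diagonal (fun _ : n => (1 : ℝ)) = 1 := diagonal_one
  rw [conjDiag, this, Matrix.mul_one, mul_eq_one_comm.mp hU]

theorem conjDiag_sub (U : Matrix n n ℝ) (a b : n → ℝ) :
    conjDiag U a - conjDiag U b = conjDiag U (fun i => a i - b i) := by
  rw [conjDiag, conjDiag, conjDiag, ← Matrix.sub_mul, ← Matrix.mul_sub, diagonal_sub]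

theorem smul_conjDiag (U : Matrix n n ℝ) (a : n → ℝ) (c : ℝ) :
    c • conjDiag U a = conjDiag U (fun i => c * a i) := by
  have : diagonal (fun i => c * a i) = c • diagonal a := by
    rw [← diagonal_smul]; rfl
  rw [conjDiag, conjDiag, this, Matrix.mul_smul, Matrix.smul_mul]

theorem conjDiag_mul {U : Matrix n n ℝ} (hU : Uᵀ * U = 1) (a b : n → ℝ) :
    conjDiag U a * conjDiag U b = conjDiag U (fun i => a i * b i) := by
  calc conjDiag U a * conjDiag U b = U * diagonal a * (Uᵀ * U) * diagonal b * Uᵀ := by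
        simp only [conjDiag, Matrix.mul_assoc]
    _ = _ := by rw [hU, Matrix.mul_one, Matrix.mul_assoc U, diagonal_mul_diagonal, conjDiag]

theorem exp_conjDiag {U : Matrix n n ℝ} (hU : Uᵀ * U = 1) (a : n → ℝ) :
    NormedSpace.exp (conjDiag U a) = conjDiag U (fun i => Real.exp (a i)) := by
  have hinv : U⁻¹ = Uᵀ := inv_eq_left_inv hU
  have hu : IsUnit U := IsUnit.of_mul_eq_one _ (mul_eq_one_comm.mp hU)
  rw [conjDiag, ← hinv, Matrix.exp_conj _ _ hu, Matrix.exp_diagonal, hinv, conjDiag]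
  congr 3
  ext i
  rw [Pi.coe_exp, Real.exp_eq_exp_ℝ]

theorem dotProduct_conjDiag_mulVec (U : Matrix n n ℝ) (a x : n → ℝ) :
    x ⬝ᵥ conjDiag U a *ᵥ x = ∑ i, a i * (Uᵀ *ᵥ x) i ^ 2 := by
  rw [conjDiag, ← mulVec_mulVec, ← mulVec_mulVec, dotProduct_mulVec, ← mulVec_transpose]
  simp only [dotProduct, mulVec_diagonal]
  exact Finset.sum_congr rfl fun i _ => by ring

theorem trace_conjDiag {U : Matrix n n ℝ} (hU : Uᵀ * U = 1) (a : n → ℝ) :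
    (conjDiag U a).trace = ∑ i, a i := by
  rw [conjDiag, trace_mul_comm, ← Matrix.mul_assoc, hU, Matrix.one_mul, trace_diagonal]

theorem posSemidef_conjDiag (U : Matrix n n ℝ) {a : n → ℝ} (ha : ∀ i, 0 ≤ a i) :
    (conjDiag U a).PosSemidef := by
  refine PosSemidef.of_dotProduct_mulVec_nonneg (conjDiag_isHermitian U a) fun x => ?_
  rw [star_trivial, dotProduct_conjDiag_mulVec]
  exact Finset.sum_nonneg fun i _ => mul_nonneg (ha i) (sq_nonneg _)

/-- The coefficients of a given diagonalization are values of the quadratic form at the columns of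
`U`. Definiteness thus passes to them without matching them to a canonical list of eigenvalues. -/
theorem eigenvalue_eq_dotProduct {U : Matrix n n ℝ} (hU : Uᵀ * U = 1) (a : n → ℝ) (i : n) :
    a i = U.col i ⬝ᵥ conjDiag U a *ᵥ U.col i := by
  have h : Uᵀ *ᵥ U.col i = Pi.single i 1 := by
    rw [← mulVec_single_one U i, mulVec_mulVec, hU, one_mulVec]
  rw [dotProduct_conjDiag_mulVec, h]
  rw [Finset.sum_eq_single i] <;> simp +contextual

theorem col_dotProduct_self {U : Matrix n n ℝ} (hU : Uᵀ * U = 1) (i : n) :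
    U.col i ⬝ᵥ U.col i = 1 := by
  have := congr_fun (congr_fun hU i) i
  rwa [one_apply_eq, mul_apply] at this

theorem eigenvalue_nonneg {U : Matrix n n ℝ} (hU : Uᵀ * U = 1) {a : n → ℝ}
    (h : (conjDiag U a).PosSemidef) (i : n) : 0 ≤ a i := by
  rw [eigenvalue_eq_dotProduct hU a i]
  simpa using h.dotProduct_mulVec_nonneg (U.col i)

theorem eigenvalue_pos {U : Matrix n n ℝ} (hU : Uᵀ * U = 1) {a : n → ℝ}
    (h : (conjDiag U a).PosDef) (i : n) : 0 < a i := by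
  rw [eigenvalue_eq_dotProduct hU a i]
  have hne : U.col i ≠ 0 := fun h0 => by simpa [h0] using col_dotProduct_self hU i
  simpa using h.dotProduct_mulVec_pos hne

theorem posDef_conjDiag {U : Matrix n n ℝ} (hU : Uᵀ * U = 1) {a : n → ℝ} (ha : ∀ i, 0 < a i) :
    (conjDiag U a).PosDef := by
  have h2 : conjDiag U (fun i => (a i)⁻¹) * conjDiag U a = 1 := by
    rw [conjDiag_mul hU, ← conjDiag_one hU]
    congr 1
    ext i
    exact inv_mul_cancel₀ (ha i).ne'
  exact (posSemidef_conjDiag U fun i => (ha i).le).posDef_iff_isUnit.mpr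
    (IsUnit.of_mul_eq_one_right _ h2)

theorem posDef_exp {A : Matrix n n ℝ} (hA : A.IsHermitian) : (NormedSpace.exp A).PosDef := by
  obtain ⟨U, a, hU, rfl⟩ := exists_eq_conjDiag hA
  rw [exp_conjDiag hU]
  exact posDef_conjDiag hU fun i => Real.exp_pos _

theorem exists_exp_eq {T : Matrix n n ℝ} (hT : T.PosDef) :
    ∃ τ : Matrix n n ℝ, τ.IsHermitian ∧ NormedSpace.exp τ = T := by
  obtain ⟨U, t, hU, rfl⟩ := exists_eq_conjDiag hT.isHermitian
  refine ⟨conjDiag U fun i => Real.log (t i), conjDiag_isHermitian _ _, ?_⟩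
  rw [exp_conjDiag hU]
  congr 1
  ext i
  exact Real.exp_log (eigenvalue_pos hU hT i)

theorem trace_conjDiag_mul (U : Matrix n n ℝ) (a : n → ℝ) (B : Matrix n n ℝ) :
    (conjDiag U a * B).trace = ∑ i, a i * (U.col i ⬝ᵥ B *ᵥ U.col i) := by
  rw [conjDiag, Matrix.mul_assoc, Matrix.mul_assoc, trace_mul_comm, Matrix.mul_assoc]
  rw [trace]
  refine Finset.sum_congr rfl fun i _ => ?_
  rw [diag_apply, diagonal_mul, Matrix.mul_assoc, mul_apply]
  rfl

theorem trace_mul_nonneg_of_posSemidef {A B : Matrix n n ℝ} (hA : A.PosSemidef)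
    (hB : B.PosSemidef) : 0 ≤ (A * B).trace := by
  obtain ⟨U, a, hU, rfl⟩ := exists_eq_conjDiag hA.isHermitian
  rw [trace_conjDiag_mul]
  exact Finset.sum_nonneg fun i _ => mul_nonneg (eigenvalue_nonneg hU hA i)
    (by simpa using hB.dotProduct_mulVec_nonneg (U.col i))

/-- The squared overlaps of two orthonormal bases. -/
def overlap (U V : Matrix n n ℝ) (i j : n) : ℝ := (Uᵀ * V) i j ^ 2

omit [DecidableEq n] in
theorem overlap_nonneg (U V : Matrix n n ℝ) (i j : n) : 0 ≤ overlap U V i j := sq_nonneg _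

/-- `Uᵀ V` is orthogonal, so its squared entries form a doubly stochastic matrix. Averaging against
it carries scalar inequalities over to traces of matrices with different eigenbases. -/
theorem overlap_sum_right {U V : Matrix n n ℝ} (hU : Uᵀ * U = 1) (hV : Vᵀ * V = 1) (i : n) :
    ∑ j, overlap U V i j = 1 := by
  have h : (Uᵀ * V) * (Uᵀ * V)ᵀ = 1 := by
    rw [transpose_mul, transpose_transpose, Matrix.mul_assoc, ← Matrix.mul_assoc V,
      mul_eq_one_comm.mp hV, Matrix.one_mul, hU]
  have := congr_fun (congr_fun h i) i
  rw [one_apply_eq, mul_apply] at this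
  simpa [overlap, sq] using this

theorem overlap_sum_left {U V : Matrix n n ℝ} (hU : Uᵀ * U = 1) (hV : Vᵀ * V = 1) (j : n) :
    ∑ i, overlap U V i j = 1 := by
  have h := overlap_sum_right hV hU j
  rw [← h]
  refine Finset.sum_congr rfl fun i _ => ?_
  rw [overlap, overlap, ← transpose_apply (Uᵀ * V), transpose_mul, transpose_transpose]

theorem trace_conjDiag_mul_conjDiag (U V : Matrix n n ℝ) (a b : n → ℝ) :
    (conjDiag U a * conjDiag V b).trace = ∑ i, ∑ j, overlap U V i j * (a i * b j) := by
  rw [trace_conjDiag_mul]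
  refine Finset.sum_congr rfl fun i _ => ?_
  rw [dotProduct_conjDiag_mulVec, Finset.mul_sum]
  refine Finset.sum_congr rfl fun j _ => ?_
  have : (Vᵀ *ᵥ U.col i) j = (Uᵀ * V) i j := by
    rw [← transpose_apply (Uᵀ * V), transpose_mul, transpose_transpose, mul_apply]
    rfl
  rw [this, overlap]
  ring

/-- The gradient inequality for the convex function `tr exp`. -/
theorem trace_exp_tangent_le {τ Y : Matrix n n ℝ} (hτ : τ.IsHermitian) (hY : Y.IsHermitian) :
    (NormedSpace.exp τ).trace + (NormedSpace.exp τ * (Y - τ)).trace ≤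
      (NormedSpace.exp Y).trace := by
  obtain ⟨U, t, hU, rfl⟩ := exists_eq_conjDiag hτ
  obtain ⟨V, y, hV, rfl⟩ := exists_eq_conjDiag hY
  rw [exp_conjDiag hU, exp_conjDiag hV, Matrix.mul_sub, trace_sub, conjDiag_mul hU,
    trace_conjDiag hU, trace_conjDiag hV, trace_conjDiag hU, trace_conjDiag_mul_conjDiag]
  have h1 (f : n → ℝ) : ∑ i, f i = ∑ i, ∑ j, overlap U V i j * f i := by
    simp_rw [← Finset.sum_mul, overlap_sum_right hU hV, one_mul]
  have h2 (f : n → ℝ) : ∑ j, f j = ∑ i, ∑ j, overlap U V i j * f j := by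
    rw [Finset.sum_comm]
    simp_rw [← Finset.sum_mul, overlap_sum_left hU hV, one_mul]
  -- Once every single sum is spread over both bases, what remains is the scalar tangent inequality
  -- `exp t + exp t * (y - t) ≤ exp y`, weighted by the overlaps.
  rw [h1 fun i => Real.exp (t i), h1 fun i => Real.exp (t i) * t i, h2 fun i => Real.exp (y i)]
  simp only [← Finset.sum_sub_distrib, ← Finset.sum_add_distrib]
  gcongr with i _ j _
  have h3 := Real.add_one_le_exp (y j - t i)
  have h4 : Real.exp (y j) = Real.exp (t i) * Real.exp (y j - t i) := by
    rw [← Real.exp_add]; congr 1; ring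
  rw [h4]
  nlinarith [mul_le_mul_of_nonneg_left (mul_le_mul_of_nonneg_left h3 (Real.exp_pos (t i)).le)
    (overlap_nonneg U V i j)]

theorem posSemidef_exp_sub_one_sub {A : Matrix n n ℝ} (hA : A.IsHermitian) :
    (NormedSpace.exp A - 1 - A).PosSemidef := by
  obtain ⟨U, a, hU, rfl⟩ := exists_eq_conjDiag hA
  rw [exp_conjDiag hU, ← conjDiag_one hU, conjDiag_sub, conjDiag_sub]
  exact posSemidef_conjDiag U fun i => by linarith [Real.add_one_le_exp (a i)]

/-- A convex function lies below its chord, here between `-1` and `0`. This is the source of the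
factor `1 - e⁻¹`. -/
theorem exp_neg_le_of_mem_Icc {x : ℝ} (h0 : 0 ≤ x) (h1 : x ≤ 1) :
    Real.exp (-x) ≤ 1 - (1 - Real.exp (-1)) * x := by
  have := convexOn_exp.2 (Set.mem_univ 0) (Set.mem_univ (-1)) (sub_nonneg.mpr h1) h0 (by ring)
  simp only [smul_eq_mul, Real.exp_zero] at this
  have e : (1 - x) * 0 + x * -1 = -x := by ring
  rw [e] at this
  linarith

theorem posSemidef_one_sub_smul_sub_exp_neg {X : Matrix n n ℝ} (h0 : X.PosSemidef)
    (h1 : (1 - X).PosSemidef) :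
    (1 - (1 - Real.exp (-1)) • X - NormedSpace.exp (-X)).PosSemidef := by
  obtain ⟨U, x, hU, rfl⟩ := exists_eq_conjDiag h0.isHermitian
  have h1' : (conjDiag U fun i => 1 - x i).PosSemidef := by
    rwa [← conjDiag_one hU, conjDiag_sub] at h1
  have e : -conjDiag U x = conjDiag U fun i => -1 * x i := by
    rw [← smul_conjDiag, neg_one_smul]
  rw [e, exp_conjDiag hU, ← conjDiag_one hU, smul_conjDiag, conjDiag_sub, conjDiag_sub]
  refine posSemidef_conjDiag U fun i => ?_
  have := exp_neg_le_of_mem_Icc (eigenvalue_nonneg hU h0 i)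
    (by linarith [eigenvalue_nonneg hU h1' i])
  rw [neg_one_mul]
  linarith

/-- The largest eigenvalue of `Y` is at most `log tr exp Y`. -/
theorem posSemidef_log_smul_one_sub {Y : Matrix n n ℝ} (hY : Y.IsHermitian) {r : ℝ}
    (h : (NormedSpace.exp Y).trace ≤ r) : (Real.log r • (1 : Matrix n n ℝ) - Y).PosSemidef := by
  obtain ⟨U, y, hU, rfl⟩ := exists_eq_conjDiag hY
  rw [exp_conjDiag hU, trace_conjDiag hU] at h
  rw [← conjDiag_one hU, smul_conjDiag, conjDiag_sub]
  refine posSemidef_conjDiag U fun i => ?_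
  have h1 : Real.exp (y i) ≤ r := (Finset.single_le_sum (f := fun i => Real.exp (y i))
    (fun i _ => (Real.exp_pos _).le) (Finset.mem_univ i)).trans h
  have := (Real.le_log_iff_exp_le ((Real.exp_pos _).trans_le h1)).mpr h1
  linarith

theorem continuous_trace_exp :
    Continuous fun A : Matrix n n ℝ => (NormedSpace.exp A).trace := by
  have : Continuous (NormedSpace.exp : Matrix n n ℝ → Matrix n n ℝ) := by
    -- The claim involves only the topology of matrices; the norm is local and serves to invoke
    -- continuity of `exp`.
    let _ : NormedRing (Matrix n n ℝ) := Matrix.linftyOpNormedRing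
    let _ : NormedAlgebra ℝ (Matrix n n ℝ) := Matrix.linftyOpNormedAlgebra
    let _ : NormedAlgebra ℚ (Matrix n n ℝ) := NormedAlgebra.restrictScalars ℚ ℝ _
    exact NormedSpace.exp_continuous
  exact this.matrix_trace

end Spectral

/-! ### Joint convexity of relative entropy and the one-step trace exponential bound -/

section RelativeEntropy

variable {n : Type*} [Fintype n] [DecidableEq n]

open Matrix Filter Topology

/-- The form whose supremum over `Z` is `⟨T, (L_A + s R_T)⁻¹ T⟩`. -/
noncomputable def variationalForm (s : ℝ) (Z T A : Matrix n n ℝ) : ℝ :=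
  2 * (Zᵀ * T).trace - (Zᵀ * (A * Z)).trace - s * (Z * (T * Zᵀ)).trace

/-- The form `⟨T, (L_A + s R_T)⁻¹ T⟩` for `T = U diag t Uᵀ` and `A = V diag a Vᵀ`. -/
noncomputable def resolventForm (s : ℝ) (U : Matrix n n ℝ) (t : n → ℝ) (V : Matrix n n ℝ) (a : n → ℝ) : ℝ :=
  ∑ j, ∑ k, overlap U V j k * (t j ^ 2 / (a k + s * t j))

-- For fixed `Z` the form is linear in the pair `(T, A)`. Its supremum over `Z` is therefore jointly
-- convex.
omit [DecidableEq n] in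
theorem variationalForm_sum {ι : Type*} [Fintype ι] (s : ℝ) (Z : Matrix n n ℝ) (p : ι → ℝ)
    (T A : ι → Matrix n n ℝ) :
    variationalForm s Z (∑ i, p i • T i) (∑ i, p i • A i) =
      ∑ i, p i * variationalForm s Z (T i) (A i) := by
  simp only [variationalForm, Matrix.sum_mul, trace_sum, Matrix.mul_smul,
    Matrix.smul_mul, trace_smul, smul_eq_mul, Finset.mul_sum, ← Finset.sum_sub_distrib]
  exact Finset.sum_congr rfl fun i _ => by ring

/-- Writing `Z` in the two eigenbases decouples the form into independent scalar quadratics in the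
entries of `C`, so it can be maximized entry by entry. -/
theorem variationalForm_conj {U V : Matrix n n ℝ} (hU : Uᵀ * U = 1) (hV : Vᵀ * V = 1)
    (s : ℝ) (C : Matrix n n ℝ) (t a : n → ℝ) :
    variationalForm s (V * C * Uᵀ) (conjDiag U t) (conjDiag V a) =
      ∑ j, ∑ k, (2 * (C k j * (Uᵀ * V) j k * t j) - (a k + s * t j) * C k j ^ 2) := by
  have e1 : ((V * C * Uᵀ)ᵀ * conjDiag U t).trace = ∑ j, ∑ k, C k j * (Uᵀ * V) j k * t j := by
    have : (V * C * Uᵀ)ᵀ * conjDiag U t = U * (Cᵀ * (Uᵀ * V)ᵀ * diagonal t) * Uᵀ := by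
      simp only [conjDiag, transpose_mul, transpose_transpose, Matrix.mul_assoc]
    rw [this, trace_mul_comm, ← Matrix.mul_assoc, hU, Matrix.one_mul, trace]
    refine Finset.sum_congr rfl fun j _ => ?_
    rw [diag_apply, mul_diagonal, mul_apply, Finset.sum_mul]
    rfl
  have e2 : ((V * C * Uᵀ)ᵀ * (conjDiag V a * (V * C * Uᵀ))).trace =
      ∑ j, ∑ k, a k * C k j ^ 2 := by
    have : (V * C * Uᵀ)ᵀ * (conjDiag V a * (V * C * Uᵀ)) =
        U * (Cᵀ * ((Vᵀ * V) * (diagonal a * ((Vᵀ * V) * C)))) * Uᵀ := by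
      simp only [conjDiag, transpose_mul, transpose_transpose, Matrix.mul_assoc]
    rw [this, hV, Matrix.one_mul, Matrix.one_mul, trace_mul_comm, ← Matrix.mul_assoc, hU,
      Matrix.one_mul, trace]
    refine Finset.sum_congr rfl fun j _ => ?_
    rw [diag_apply, mul_apply]
    refine Finset.sum_congr rfl fun k _ => ?_
    rw [diagonal_mul, transpose_apply]
    ring
  have e3 : (V * C * Uᵀ * (conjDiag U t * (V * C * Uᵀ)ᵀ)).trace =
      ∑ j, ∑ k, t j * C k j ^ 2 := by
    have : V * C * Uᵀ * (conjDiag U t * (V * C * Uᵀ)ᵀ) =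
        V * (C * ((Uᵀ * U) * (diagonal t * ((Uᵀ * U) * Cᵀ)))) * Vᵀ := by
      simp only [conjDiag, transpose_mul, transpose_transpose, Matrix.mul_assoc]
    rw [this, hU, Matrix.one_mul, Matrix.one_mul, trace_mul_comm, ← Matrix.mul_assoc, hV,
      Matrix.one_mul, trace, Finset.sum_comm]
    refine Finset.sum_congr rfl fun j _ => ?_
    rw [diag_apply, mul_apply]
    refine Finset.sum_congr rfl fun k _ => ?_
    rw [diagonal_mul, transpose_apply]
    ring
  rw [variationalForm, e1, e2, e3]
  simp only [Finset.mul_sum, ← Finset.sum_sub_distrib]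
  exact Finset.sum_congr rfl fun j _ => Finset.sum_congr rfl fun k _ => by ring

theorem variationalForm_le {U V : Matrix n n ℝ} (hU : Uᵀ * U = 1) (hV : Vᵀ * V = 1)
    {s : ℝ} (hs : 0 ≤ s) (Z : Matrix n n ℝ) {t a : n → ℝ} (ht : ∀ i, 0 < t i)
    (ha : ∀ i, 0 < a i) :
    variationalForm s Z (conjDiag U t) (conjDiag V a) ≤ resolventForm s U t V a := by
  have hZ : Z = V * (Vᵀ * Z * U) * Uᵀ := by
    calc Z = (V * Vᵀ) * Z * (U * Uᵀ) := by
          rw [mul_eq_one_comm.mp hU, mul_eq_one_comm.mp hV, Matrix.one_mul, Matrix.mul_one]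
      _ = _ := by simp only [Matrix.mul_assoc]
  rw [hZ, variationalForm_conj hU hV, resolventForm]
  gcongr with j _ k _
  have hpos : 0 < a k + s * t j := add_pos_of_pos_of_nonneg (ha k) (mul_nonneg hs (ht j).le)
  rw [overlap, ← mul_div_assoc, le_div_iff₀ hpos]
  nlinarith [sq_nonneg ((a k + s * t j) * (Vᵀ * Z * U) k j - (Uᵀ * V) j k * t j)]

theorem exists_variationalForm_eq {U V : Matrix n n ℝ} (hU : Uᵀ * U = 1) (hV : Vᵀ * V = 1)
    {s : ℝ} (hs : 0 ≤ s) {t a : n → ℝ} (ht : ∀ i, 0 < t i) (ha : ∀ i, 0 < a i) :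
    ∃ Z, variationalForm s Z (conjDiag U t) (conjDiag V a) = resolventForm s U t V a := by
  -- Each entry is the vertex of the corresponding scalar parabola.
  refine ⟨V * (Matrix.of fun k j => (Uᵀ * V) j k * t j / (a k + s * t j)) * Uᵀ, ?_⟩
  rw [variationalForm_conj hU hV, resolventForm]
  refine Finset.sum_congr rfl fun j _ => Finset.sum_congr rfl fun k _ => ?_
  have hpos : 0 < a k + s * t j := add_pos_of_pos_of_nonneg (ha k) (mul_nonneg hs (ht j).le)
  rw [overlap, of_apply]
  field_simp
  ring

variable {ι : Type*} [Fintype ι] {p : ι → ℝ} {U V : Matrix n n ℝ} {t a : n → ℝ}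
  {Us Vs : ι → Matrix n n ℝ} {ts as : ι → n → ℝ}

/-- Take the `Z` that is optimal for the mixture, expand linearly, and bound each summand by its own
supremum. -/
theorem resolventForm_sum_le (hp : ∀ i, 0 ≤ p i) (hU : Uᵀ * U = 1) (hV : Vᵀ * V = 1)
    (hUs : ∀ i, (Us i)ᵀ * Us i = 1) (hVs : ∀ i, (Vs i)ᵀ * Vs i = 1)
    (ht : ∀ i, 0 < t i) (ha : ∀ i, 0 < a i) (hts : ∀ i j, 0 < ts i j) (has : ∀ i j, 0 < as i j)
    (hT : conjDiag U t = ∑ i, p i • conjDiag (Us i) (ts i))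
    (hA : conjDiag V a = ∑ i, p i • conjDiag (Vs i) (as i)) {s : ℝ} (hs : 0 ≤ s) :
    resolventForm s U t V a ≤ ∑ i, p i * resolventForm s (Us i) (ts i) (Vs i) (as i) := by
  obtain ⟨Z, hZ⟩ := exists_variationalForm_eq hU hV hs ht ha
  rw [← hZ, hT, hA, variationalForm_sum]
  gcongr with i _
  · exact hp i
  · exact variationalForm_le (hUs i) (hVs i) hs Z (hts i) (has i)

/-- The integral of `resolventForm` over `[0, R]`. -/
noncomputable def resolventIntegral (U : Matrix n n ℝ) (t : n → ℝ) (V : Matrix n n ℝ) (a : n → ℝ) (R : ℝ) : ℝ :=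
  ∑ j, ∑ k, overlap U V j k * (t j * (Real.log (a k + R * t j) - Real.log (a k)))

omit [DecidableEq n] in
theorem hasDerivAt_resolventIntegral (U V : Matrix n n ℝ) (ht : ∀ i, 0 < t i)
    (ha : ∀ i, 0 < a i) {R : ℝ} (hR : 0 ≤ R) :
    HasDerivAt (resolventIntegral U t V a) (resolventForm R U t V a) R := by
  unfold resolventIntegral resolventForm
  refine HasDerivAt.fun_sum fun j _ => HasDerivAt.fun_sum fun k _ => ?_
  refine HasDerivAt.const_mul _ ?_
  have hpos : 0 < a k + R * t j := add_pos_of_pos_of_nonneg (ha k) (mul_nonneg hR (ht j).le)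
  have := ((((hasDerivAt_id' R).mul_const (t j)).const_add (a k)).log hpos.ne').sub_const
    (Real.log (a k)) |>.const_mul (t j)
  convert this using 1
  ring

/-- Both sides vanish at `R = 0`, and the derivative of their difference has the right sign by
`resolventForm_sum_le`. No integral has to be formed. -/
theorem resolventIntegral_sum_le (hp : ∀ i, 0 ≤ p i) (hU : Uᵀ * U = 1) (hV : Vᵀ * V = 1)
    (hUs : ∀ i, (Us i)ᵀ * Us i = 1) (hVs : ∀ i, (Vs i)ᵀ * Vs i = 1)
    (ht : ∀ i, 0 < t i) (ha : ∀ i, 0 < a i) (hts : ∀ i j, 0 < ts i j) (has : ∀ i j, 0 < as i j)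
    (hT : conjDiag U t = ∑ i, p i • conjDiag (Us i) (ts i))
    (hA : conjDiag V a = ∑ i, p i • conjDiag (Vs i) (as i)) {R : ℝ} (hR : 0 ≤ R) :
    resolventIntegral U t V a R ≤
      ∑ i, p i * resolventIntegral (Us i) (ts i) (Vs i) (as i) R := by
  have hd (x : ℝ) (hx : 0 ≤ x) : HasDerivAt
      (fun R => ∑ i, p i * resolventIntegral (Us i) (ts i) (Vs i) (as i) R -
        resolventIntegral U t V a R)
      (∑ i, p i * resolventForm x (Us i) (ts i) (Vs i) (as i) - resolventForm x U t V a) x :=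
    (HasDerivAt.fun_sum fun i _ =>
      (hasDerivAt_resolventIntegral _ _ (hts i) (has i) hx).const_mul (p i)).sub
      (hasDerivAt_resolventIntegral _ _ ht ha hx)
  have hmono := monotoneOn_of_deriv_nonneg (convex_Ici (0 : ℝ))
    (fun x hx => (hd x hx).continuousAt.continuousWithinAt)
    (fun x hx => (hd x (interior_subset hx)).differentiableAt.differentiableWithinAt)
    (fun x hx => by
      rw [(hd x (interior_subset hx)).deriv, sub_nonneg]
      exact resolventForm_sum_le hp hU hV hUs hVs ht ha hts has hT hA (interior_subset hx))
  have := hmono (Set.mem_Ici.mpr le_rfl) (Set.mem_Ici.mpr hR) hR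
  simp only [resolventIntegral, zero_mul, add_zero, sub_self, mul_zero,
    Finset.sum_const_zero] at this
  exact sub_nonneg.mp this

/-- The integral diverges like `log R * tr T`. This term depends linearly on `T`, so removing it
does not affect convexity, and the limit left over is the relative entropy. -/
theorem tendsto_resolventIntegral_sub (hU : Uᵀ * U = 1) (hV : Vᵀ * V = 1) (ht : ∀ i, 0 < t i)
    (ha : ∀ i, 0 < a i) :
    Tendsto (fun R => resolventIntegral U t V a R - Real.log R * ∑ j, t j) atTop
      (𝓝 (∑ j, ∑ k, overlap U V j k * (t j * (Real.log (t j) - Real.log (a k))))) := by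
  have hlim : Tendsto (fun R => ∑ j, ∑ k, overlap U V j k *
      (t j * (Real.log (a k * R⁻¹ + t j) - Real.log (a k)))) atTop
      (𝓝 (∑ j, ∑ k, overlap U V j k * (t j * (Real.log (t j) - Real.log (a k))))) := by
    refine tendsto_finsetSum _ fun j _ => tendsto_finsetSum _ fun k _ => ?_
    refine Tendsto.const_mul _ (Tendsto.const_mul _ (Tendsto.sub_const ?_ _))
    refine (Real.continuousAt_log (ht j).ne').tendsto.comp ?_
    simpa using (tendsto_inv_atTop_zero.const_mul (a k)).add_const (t j)
  refine hlim.congr' ?_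
  filter_upwards [eventually_gt_atTop 0] with R hR
  have h1 (j : n) : Real.log R * t j = ∑ k, overlap U V j k * (Real.log R * t j) := by
    rw [← Finset.sum_mul, overlap_sum_right hU hV, one_mul]
  rw [Finset.mul_sum, resolventIntegral, ← Finset.sum_sub_distrib]
  refine Finset.sum_congr rfl fun j _ => ?_
  rw [h1 j, ← Finset.sum_sub_distrib]
  refine Finset.sum_congr rfl fun k _ => ?_
  have hpos : 0 < a k + R * t j := add_pos (ha k) (mul_pos hR (ht j))
  have : a k * R⁻¹ + t j = (a k + R * t j) / R := by field_simp
  rw [this, Real.log_div hpos.ne' hR.ne']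
  ring

/-- The redundant `Real.log (Real.exp _)` matches the limit in `tendsto_resolventIntegral_sub` for
the eigenvalues `exp t` and `exp a`. -/
theorem trace_exp_mul_sub (hU : Uᵀ * U = 1) (hV : Vᵀ * V = 1) (t a : n → ℝ) :
    (NormedSpace.exp (conjDiag U t) * (conjDiag U t - conjDiag V a)).trace =
      ∑ j, ∑ k, overlap U V j k * (Real.exp (t j) *
        (Real.log (Real.exp (t j)) - Real.log (Real.exp (a k)))) := by
  rw [exp_conjDiag hU, Matrix.mul_sub, trace_sub, conjDiag_mul hU, trace_conjDiag hU,
    trace_conjDiag_mul_conjDiag]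
  have h1 (j : n) : Real.exp (t j) * t j = ∑ k, overlap U V j k * (Real.exp (t j) * t j) := by
    rw [← Finset.sum_mul, overlap_sum_right hU hV, one_mul]
  rw [Finset.sum_congr rfl fun j _ => h1 j]
  simp only [← Finset.sum_sub_distrib, Real.log_exp, mul_sub]

/-- Joint convexity of the quantum relative entropy. -/
theorem trace_exp_mul_sub_le {τ α : Matrix n n ℝ} {τs αs : ι → Matrix n n ℝ}
    (hp : ∀ i, 0 ≤ p i) (hτ : τ.IsHermitian) (hα : α.IsHermitian)
    (hτs : ∀ i, (τs i).IsHermitian) (hαs : ∀ i, (αs i).IsHermitian)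
    (hT : NormedSpace.exp τ = ∑ i, p i • NormedSpace.exp (τs i))
    (hA : NormedSpace.exp α = ∑ i, p i • NormedSpace.exp (αs i)) :
    (NormedSpace.exp τ * (τ - α)).trace ≤
      ∑ i, p i * (NormedSpace.exp (τs i) * (τs i - αs i)).trace := by
  obtain ⟨U, t, hU, rfl⟩ := exists_eq_conjDiag hτ
  obtain ⟨V, a, hV, rfl⟩ := exists_eq_conjDiag hα
  choose Us ts hUs hts using fun i => exists_eq_conjDiag (hτs i)
  choose Vs as hVs has using fun i => exists_eq_conjDiag (hαs i)
  obtain rfl := funext hts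
  obtain rfl := funext has
  -- Equality of traces makes the subtracted `log R` terms agree on the two sides of the inequality.
  have htr := congrArg trace hT
  simp only [trace_sum, trace_smul, exp_conjDiag hU, exp_conjDiag (hUs _), trace_conjDiag hU,
    trace_conjDiag (hUs _), smul_eq_mul] at htr
  simp only [trace_exp_mul_sub hU hV, trace_exp_mul_sub (hUs _) (hVs _)]
  simp only [exp_conjDiag hU, exp_conjDiag hV, exp_conjDiag (hUs _), exp_conjDiag (hVs _)] at hT hA
  refine le_of_tendsto_of_tendsto
    (tendsto_resolventIntegral_sub hU hV (fun _ => Real.exp_pos _) (fun _ => Real.exp_pos _))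
    (tendsto_finsetSum _ fun i _ => (tendsto_resolventIntegral_sub (hUs i) (hVs i)
      (fun _ => Real.exp_pos _) (fun _ => Real.exp_pos _)).const_mul (p i)) ?_
  filter_upwards [eventually_ge_atTop 0] with R hR
  have := resolventIntegral_sum_le hp hU hV hUs hVs (fun _ => Real.exp_pos _)
    (fun _ => Real.exp_pos _) (fun _ _ => Real.exp_pos _) (fun _ _ => Real.exp_pos _) hT hA hR
  rw [htr, Finset.mul_sum]
  simp only [mul_sub, Finset.sum_sub_distrib]
  refine sub_le_sub this (le_of_eq ?_)
  exact Finset.sum_congr rfl fun i _ => by ring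

theorem posDef_sum_smul_exp (hp : ∀ i, 0 ≤ p i) (hp1 : ∑ i, p i = 1) {τs : ι → Matrix n n ℝ}
    (hτs : ∀ i, (τs i).IsHermitian) : (∑ i, p i • NormedSpace.exp (τs i)).PosDef := by
  have hpd (i : ι) := posDef_exp (hτs i)
  refine PosDef.of_dotProduct_mulVec_pos ?_ fun {x} hx => ?_
  · simp only [IsHermitian, conjTranspose_sum, conjTranspose_smul, (hpd _).isHermitian.eq,
      star_trivial]
  · simp only [sum_mulVec, smul_mulVec, dotProduct_sum, dotProduct_smul, smul_eq_mul]
    obtain ⟨i, hi, hpos⟩ : ∃ i ∈ Finset.univ, 0 < p i :=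
      Finset.exists_lt_of_sum_lt (s := Finset.univ) (f := fun _ => 0) (g := p) (by simp [hp1])
    exact Finset.sum_pos' (fun i _ => mul_nonneg (hp i) ((hpd i).dotProduct_mulVec_pos hx).le)
      ⟨i, hi, mul_pos hpos ((hpd i).dotProduct_mulVec_pos hx)⟩

/-- One step of the matrix Chernoff bound: if the random matrix `X` takes values between `0` and
`1` and `V` is at most its mean, then `E tr exp (Y + (1 - e⁻¹) V - X) ≤ tr exp Y`. -/
theorem sum_trace_exp_le (hp : ∀ i, 0 ≤ p i) (hp1 : ∑ i, p i = 1) {Y W : Matrix n n ℝ}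
    {X : ι → Matrix n n ℝ} (hY : Y.IsHermitian) (hW : W.IsHermitian)
    (hX0 : ∀ i, (X i).PosSemidef) (hX1 : ∀ i, (1 - X i).PosSemidef)
    (hWX : (∑ i, p i • X i - W).PosSemidef) :
    ∑ i, p i * (NormedSpace.exp (Y + (1 - Real.exp (-1)) • W - X i)).trace ≤
      (NormedSpace.exp Y).trace := by
  set c : ℝ := 1 - Real.exp (-1)
  have hc : 0 ≤ c := sub_nonneg.mpr (Real.exp_le_one_iff.mpr (by norm_num))
  have hH : (Y + c • W).IsHermitian := hY.add (hW.smul (IsSelfAdjoint.all c))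
  have hτs (i : ι) : (Y + c • W - X i).IsHermitian := hH.sub (hX0 i).isHermitian
  have hαs (i : ι) : (-X i).IsHermitian := (hX0 i).isHermitian.neg
  -- Here `τ = log E exp (Y + c W - X)` and `α = log E exp (-X)`, where `E` averages with the
  -- weights `p`.
  obtain ⟨τ, hτ, hTτ⟩ := exists_exp_eq (posDef_sum_smul_exp hp hp1 hτs)
  obtain ⟨α, hα, hAα⟩ := exists_exp_eq (posDef_sum_smul_exp hp hp1 hαs)
  have h1 := trace_exp_mul_sub_le hp hτ hα hτs hαs hTτ hAα
  have h2 := trace_exp_tangent_le hτ hY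
  -- The two exponents were paired so that their difference `Y + c W` does not depend on `i`; the
  -- average then falls on the exponential alone.
  have e1 : ∑ i, p i * (NormedSpace.exp (Y + c • W - X i) * (Y + c • W - X i - -X i)).trace =
      (NormedSpace.exp τ * (Y + c • W)).trace := by
    rw [hTτ, Finset.sum_mul, trace_sum]
    refine Finset.sum_congr rfl fun i _ => ?_
    rw [sub_neg_eq_add, sub_add_cancel, Matrix.smul_mul, trace_smul, smul_eq_mul]
  have e2 : (NormedSpace.exp τ).trace =
      ∑ i, p i * (NormedSpace.exp (Y + c • W - X i)).trace := by
    rw [hTτ, trace_sum]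
    exact Finset.sum_congr rfl fun i _ => by rw [trace_smul, smul_eq_mul]
  -- The chain is `α ≤ exp α - 1 = E exp (-X) - 1 ≤ -c E X ≤ -c W`. Only `1 + x ≤ exp x` is used,
  -- not operator monotonicity of the logarithm.
  have h3 : (-(c • W) - α).PosSemidef := by
    have ha := posSemidef_exp_sub_one_sub hα
    have hb : (∑ i, p i • (1 - c • X i - NormedSpace.exp (-X i))).PosSemidef :=
      posSemidef_sum _ fun i _ => (posSemidef_one_sub_smul_sub_exp_neg (hX0 i) (hX1 i)).smul (hp i)
    have hd := (ha.add hb).add (hWX.smul hc)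
    convert hd using 1
    simp only [smul_sub, Finset.sum_sub_distrib, ← Finset.sum_smul, hp1, one_smul, hAα,
      Finset.smul_sum, smul_comm c]
    abel
  have h4 := trace_mul_nonneg_of_posSemidef (posDef_exp hτ).posSemidef h3
  rw [← e2]
  rw [e1] at h1
  simp only [Matrix.mul_sub, Matrix.mul_add, Matrix.mul_neg, trace_sub, trace_add,
    trace_neg] at h1 h2 h4
  linarith

end RelativeEntropy

/-! ### Gradient and Hessian of the multinomial logit loss -/

namespace MNLModel

variable {S A : Type*} [Fintype S] [DecidableEq S] [MeasurableSpace A] {d H : ℕ}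

open Matrix

/-- The feature vector of the transition to `s'`. -/
def feature (M : MNLModel S A d H) (s : S) (a : A) (s' : S) : EuclideanSpace ℝ (Fin d) :=
  WithLp.toLp 2 (M.Φ s a s')

/-- The mean feature vector under the parameter `θ`. -/
noncomputable def meanFeature (M : MNLModel S A d H) (h : ℕ) (s : S) (a : A)
    (θ : EuclideanSpace ℝ (Fin d)) : EuclideanSpace ℝ (Fin d) :=
  ∑ t, M.prob h s a θ t • M.feature s a t

/-- The covariance matrix of the features under the parameter `θ`. -/
noncomputable def featureCov (M : MNLModel S A d H) (h : ℕ) (s : S) (a : A)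
    (θ : EuclideanSpace ℝ (Fin d)) : Matrix (Fin d) (Fin d) ℝ :=
  Matrix.of fun i j => ∑ t, M.prob h s a θ t *
    ((M.feature s a t j - M.meanFeature h s a θ j) * M.feature s a t i)

/-- The gradient of the loss. -/
noncomputable def lossGrad (M : MNLModel S A d H) (h : ℕ) (s : S) (a : A) (s' : S)
    (θ : EuclideanSpace ℝ (Fin d)) : EuclideanSpace ℝ (Fin d) :=
  if s' ∈ M.reach h s a then M.meanFeature h s a θ - M.feature s a s' else 0

theorem norm_feature_le (M : MNLModel S A d H) (s : S) (a : A) (s' : S) :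
    ‖M.feature s a s'‖ ≤ M.BΦ := by
  have := M.norm_Φ_le s a s'
  rwa [mulVec_single_one] at this

theorem BΦ_nonneg (M : MNLModel S A d H) (s : S) (a : A) : 0 ≤ M.BΦ :=
  (norm_nonneg _).trans (M.norm_feature_le s a s)

theorem mulVec_eq_inner (M : MNLModel S A d H) (s : S) (a : A) (s' : S)
    (θ : EuclideanSpace ℝ (Fin d)) :
    (M.Φ s a).mulVec θ.ofLp s' = inner ℝ (M.feature s a s') θ := by
  simp [feature, mulVec, dotProduct, PiLp.inner_apply, mul_comm]

/-- The normalizing factor of the transition probabilities. -/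
noncomputable def partition (M : MNLModel S A d H) (h : ℕ) (s : S) (a : A)
    (θ : EuclideanSpace ℝ (Fin d)) : ℝ :=
  ∑ t ∈ M.reach h s a, Real.exp (inner ℝ (M.feature s a t) θ)

theorem partition_pos (M : MNLModel S A d H) (h : ℕ) (s : S) (a : A)
    (θ : EuclideanSpace ℝ (Fin d)) : 0 < M.partition h s a θ :=
  Finset.sum_pos (fun _ _ => Real.exp_pos _) (M.reach_nonempty h s a)

theorem prob_of_mem (M : MNLModel S A d H) {h : ℕ} {s : S} {a : A} {s' : S}
    (hs' : s' ∈ M.reach h s a) (θ : EuclideanSpace ℝ (Fin d)) :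
    M.prob h s a θ s' = Real.exp (inner ℝ (M.feature s a s') θ) / M.partition h s a θ := by
  simp only [prob, if_pos hs', mulVec_eq_inner, partition]

theorem prob_of_notMem (M : MNLModel S A d H) {h : ℕ} {s : S} {a : A} {s' : S}
    (hs' : s' ∉ M.reach h s a) (θ : EuclideanSpace ℝ (Fin d)) : M.prob h s a θ s' = 0 :=
  if_neg hs'

theorem prob_nonneg (M : MNLModel S A d H) (h : ℕ) (s : S) (a : A)
    (θ : EuclideanSpace ℝ (Fin d)) (s' : S) : 0 ≤ M.prob h s a θ s' := by
  by_cases hs' : s' ∈ M.reach h s a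
  · rw [M.prob_of_mem hs']
    exact div_nonneg (Real.exp_pos _).le (M.partition_pos h s a θ).le
  · exact (M.prob_of_notMem hs' θ).ge

theorem sum_prob_mul (M : MNLModel S A d H) (h : ℕ) (s : S) (a : A)
    (θ : EuclideanSpace ℝ (Fin d)) {E : Type*} [AddCommGroup E] [Module ℝ E] (f : S → E) :
    ∑ t, M.prob h s a θ t • f t = (M.partition h s a θ)⁻¹ •
      ∑ t ∈ M.reach h s a, Real.exp (inner ℝ (M.feature s a t) θ) • f t := by
  rw [Finset.smul_sum, ← Finset.sum_subset (Finset.subset_univ (M.reach h s a))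
    fun t _ ht => by rw [M.prob_of_notMem ht, zero_smul]]
  refine Finset.sum_congr rfl fun t ht => ?_
  rw [M.prob_of_mem ht, div_eq_inv_mul, mul_smul]

theorem sum_prob (M : MNLModel S A d H) (h : ℕ) (s : S) (a : A)
    (θ : EuclideanSpace ℝ (Fin d)) : ∑ t, M.prob h s a θ t = 1 := by
  have := M.sum_prob_mul h s a θ (fun _ => (1 : ℝ))
  simp only [smul_eq_mul, mul_one] at this
  rw [this]
  exact inv_mul_cancel₀ (M.partition_pos h s a θ).ne'

theorem norm_meanFeature_le (M : MNLModel S A d H) (h : ℕ) (s : S) (a : A)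
    (θ : EuclideanSpace ℝ (Fin d)) : ‖M.meanFeature h s a θ‖ ≤ M.BΦ := by
  calc ‖M.meanFeature h s a θ‖ ≤ ∑ t, M.prob h s a θ t * M.BΦ := by
        refine (norm_sum_le _ _).trans (Finset.sum_le_sum fun t _ => ?_)
        rw [norm_smul, Real.norm_of_nonneg (M.prob_nonneg h s a θ t)]
        exact mul_le_mul_of_nonneg_left (M.norm_feature_le s a t) (M.prob_nonneg h s a θ t)
    _ = M.BΦ := by rw [← Finset.sum_mul, sum_prob, one_mul]

theorem norm_lossGrad_le (M : MNLModel S A d H) (h : ℕ) (s : S) (a : A) (s' : S)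
    (θ : EuclideanSpace ℝ (Fin d)) : ‖M.lossGrad h s a s' θ‖ ≤ 2 * M.BΦ := by
  rw [lossGrad]
  split_ifs
  · have h1 := norm_sub_le (M.meanFeature h s a θ) (M.feature s a s')
    linarith [M.norm_meanFeature_le h s a θ, M.norm_feature_le s a s']
  · simpa using M.BΦ_nonneg s a

theorem hasFDerivAt_partition (M : MNLModel S A d H) (h : ℕ) (s : S) (a : A)
    (θ : EuclideanSpace ℝ (Fin d)) :
    HasFDerivAt (M.partition h s a)
      (M.partition h s a θ • innerSL ℝ (M.meanFeature h s a θ)) θ := by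
  have h1 : HasFDerivAt (M.partition h s a) (∑ t ∈ M.reach h s a,
      Real.exp (inner ℝ (M.feature s a t) θ) • innerSL ℝ (M.feature s a t)) θ := by
    unfold partition
    exact HasFDerivAt.fun_sum fun t _ => (innerSL ℝ (M.feature s a t)).hasFDerivAt.exp
  convert h1 using 1
  rw [meanFeature, sum_prob_mul, ← map_smul, smul_inv_smul₀ (M.partition_pos h s a θ).ne', map_sum]
  simp only [map_smul]

theorem hasGradientAt_loss (M : MNLModel S A d H) (h : ℕ) (s : S) (a : A) (s' : S)
    (θ : EuclideanSpace ℝ (Fin d)) :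
    HasGradientAt (M.loss h s a s') (M.lossGrad h s a s' θ) θ := by
  rw [hasGradientAt_iff_hasFDerivAt]
  by_cases hs' : s' ∈ M.reach h s a
  · have hf : M.loss h s a s' = fun θ =>
        Real.log (M.partition h s a θ) - innerSL ℝ (M.feature s a s') θ := by
      ext x
      rw [loss, M.prob_of_mem hs', Real.log_div (Real.exp_ne_zero _) (M.partition_pos h s a x).ne',
        Real.log_exp, innerSL_apply_apply]
      ring
    rw [hf, lossGrad, if_pos hs']
    have h1 := ((M.hasFDerivAt_partition h s a θ).log (M.partition_pos h s a θ).ne').sub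
      (innerSL ℝ (M.feature s a s')).hasFDerivAt
    rw [inv_smul_smul₀ (M.partition_pos h s a θ).ne', ← map_sub] at h1
    exact h1
  -- For an unreachable state the convention `Real.log 0 = 0` makes the loss identically zero.
  · have hf : M.loss h s a s' = fun _ => 0 := by
      ext x
      rw [loss, M.prob_of_notMem hs', Real.log_zero, neg_zero]
    rw [hf, lossGrad, if_neg hs', map_zero]
    exact hasFDerivAt_const _ _

theorem gradient_loss (M : MNLModel S A d H) (h : ℕ) (s : S) (a : A) (s' : S) :
    gradient (M.loss h s a s') = M.lossGrad h s a s' :=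
  funext fun θ => (M.hasGradientAt_loss h s a s' θ).gradient

theorem hasFDerivAt_prob (M : MNLModel S A d H) (h : ℕ) (s : S) (a : A) (s' : S)
    (θ : EuclideanSpace ℝ (Fin d)) :
    HasFDerivAt (fun θ => M.prob h s a θ s')
      (M.prob h s a θ s' • innerSL ℝ (M.feature s a s' - M.meanFeature h s a θ)) θ := by
  by_cases hs' : s' ∈ M.reach h s a
  · have hpos := (M.partition_pos h s a θ).ne'
    have hf : (fun θ => M.prob h s a θ s') = fun θ =>
        Real.exp (innerSL ℝ (M.feature s a s') θ) * (M.partition h s a θ)⁻¹ := by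
      ext x
      rw [M.prob_of_mem hs', div_eq_mul_inv, innerSL_apply_apply]
    rw [hf, M.prob_of_mem hs']
    have h1 := (innerSL ℝ (M.feature s a s')).hasFDerivAt (x := θ) |>.exp.mul
      ((hasDerivAt_inv hpos).comp_hasFDerivAt θ (M.hasFDerivAt_partition h s a θ))
    refine h1.congr_fderiv (ContinuousLinearMap.ext fun v => ?_)
    simp only [map_sub, _root_.smul_apply, _root_.sub_apply, _root_.add_apply, smul_eq_mul, innerSL_apply_apply, Function.comp_apply]
    field_simp
    ring
  · simp only [M.prob_of_notMem hs', zero_smul]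
    exact hasFDerivAt_const _ _

/-- The observed state enters the gradient only as a constant, so the Hessian is the same for every
reachable outcome and is determined by the history. -/
theorem hessian_loss_of_mem (M : MNLModel S A d H) {h : ℕ} {s : S} {a : A} {s' : S}
    (hs' : s' ∈ M.reach h s a) (θ : EuclideanSpace ℝ (Fin d)) :
    hessian (M.loss h s a s') θ = M.featureCov h s a θ := by
  have h1 : HasFDerivAt (gradient (M.loss h s a s'))
      (∑ t, (M.prob h s a θ t • innerSL ℝ (M.feature s a t - M.meanFeature h s a θ)).smulRight
        (M.feature s a t)) θ := by
    have hf : gradient (M.loss h s a s') = fun θ => M.meanFeature h s a θ - M.feature s a s' := by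
      rw [gradient_loss]
      ext1 x
      rw [lossGrad, if_pos hs']
    rw [hf]
    unfold meanFeature
    exact (HasFDerivAt.fun_sum fun t _ =>
      (M.hasFDerivAt_prob h s a t θ).smul_const (M.feature s a t)).sub_const _
  ext i j
  rw [hessian, of_apply, h1.fderiv, featureCov, of_apply]
  simp [mul_assoc, EuclideanSpace.inner_single_right]

theorem hessian_loss_of_notMem (M : MNLModel S A d H) {h : ℕ} {s : S} {a : A} {s' : S}
    (hs' : s' ∉ M.reach h s a) (θ : EuclideanSpace ℝ (Fin d)) :
    hessian (M.loss h s a s') θ = 0 := by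
  have hf : gradient (M.loss h s a s') = fun _ => 0 := by
    rw [gradient_loss]
    ext1 x
    rw [lossGrad, if_neg hs']
  ext i j
  simp [hessian, hf]

theorem dotProduct_meanFeature (M : MNLModel S A d H) (h : ℕ) (s : S) (a : A)
    (θ : EuclideanSpace ℝ (Fin d)) (x : Fin d → ℝ) :
    x ⬝ᵥ (M.meanFeature h s a θ).ofLp =
      ∑ t, M.prob h s a θ t * (x ⬝ᵥ (M.feature s a t).ofLp) := by
  simp [meanFeature, WithLp.ofLp_sum, dotProduct_sum, dotProduct_smul]

theorem featureCov_apply (M : MNLModel S A d H) (h : ℕ) (s : S) (a : A)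
    (θ : EuclideanSpace ℝ (Fin d)) (i j : Fin d) :
    M.featureCov h s a θ i j = ∑ t, M.prob h s a θ t * (M.feature s a t i * M.feature s a t j) -
      M.meanFeature h s a θ i * M.meanFeature h s a θ j := by
  have h1 : M.meanFeature h s a θ i = ∑ t, M.prob h s a θ t * M.feature s a t i := by
    simp [meanFeature]
  rw [featureCov, of_apply]
  conv_rhs => rw [h1]
  rw [Finset.sum_mul, ← Finset.sum_sub_distrib]
  exact Finset.sum_congr rfl fun t _ => by ring

theorem isHermitian_featureCov (M : MNLModel S A d H) (h : ℕ) (s : S) (a : A)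
    (θ : EuclideanSpace ℝ (Fin d)) : (M.featureCov h s a θ).IsHermitian := by
  ext i j
  simp only [conjTranspose_apply, star_trivial, featureCov_apply]
  congr 1
  · exact Finset.sum_congr rfl fun t _ => by ring
  · ring

theorem featureCov_eq (M : MNLModel S A d H) (h : ℕ) (s : S) (a : A)
    (θ : EuclideanSpace ℝ (Fin d)) :
    M.featureCov h s a θ =
      ∑ t, M.prob h s a θ t • vecMulVec (M.feature s a t).ofLp (M.feature s a t).ofLp -
      vecMulVec (M.meanFeature h s a θ).ofLp (M.meanFeature h s a θ).ofLp := by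
  ext i j
  rw [featureCov_apply]
  simp [Matrix.sum_apply, vecMulVec_apply]

theorem _root_.dotProduct_vecMulVec_mulVec {n : Type*} [Fintype n] (x v : n → ℝ) :
    x ⬝ᵥ vecMulVec v v *ᵥ x = (x ⬝ᵥ v) ^ 2 := by
  rw [vecMulVec_mulVec, dotProduct_comm v x]
  simp [sq]

theorem dotProduct_featureCov_mulVec (M : MNLModel S A d H) (h : ℕ) (s : S) (a : A)
    (θ : EuclideanSpace ℝ (Fin d)) (x : Fin d → ℝ) :
    x ⬝ᵥ M.featureCov h s a θ *ᵥ x =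
      ∑ t, M.prob h s a θ t * (x ⬝ᵥ (M.feature s a t).ofLp) ^ 2 -
        (x ⬝ᵥ (M.meanFeature h s a θ).ofLp) ^ 2 := by
  rw [featureCov_eq, sub_mulVec, dotProduct_sub, sum_mulVec, dotProduct_sum]
  simp only [smul_mulVec, dotProduct_smul, dotProduct_vecMulVec_mulVec, smul_eq_mul]

/-- Bias-variance decomposition in the direction `x`. With `r` the mean under another parameter, the
square on the right is the surplus of the gradient's second moment over the covariance. -/
theorem sum_prob_mul_sub_sq (M : MNLModel S A d H) (h : ℕ) (s : S) (a : A)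
    (θ : EuclideanSpace ℝ (Fin d)) (x : Fin d → ℝ) (r : ℝ) :
    ∑ t, M.prob h s a θ t * (r - x ⬝ᵥ (M.feature s a t).ofLp) ^ 2 =
      x ⬝ᵥ M.featureCov h s a θ *ᵥ x + (r - x ⬝ᵥ (M.meanFeature h s a θ).ofLp) ^ 2 := by
  have h1 : ∑ t, M.prob h s a θ t * (r - x ⬝ᵥ (M.feature s a t).ofLp) ^ 2 =
      r ^ 2 * ∑ t, M.prob h s a θ t -
        2 * r * ∑ t, M.prob h s a θ t * (x ⬝ᵥ (M.feature s a t).ofLp) +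
        ∑ t, M.prob h s a θ t * (x ⬝ᵥ (M.feature s a t).ofLp) ^ 2 := by
    rw [Finset.mul_sum, Finset.mul_sum, ← Finset.sum_sub_distrib, ← Finset.sum_add_distrib]
    exact Finset.sum_congr rfl fun t _ => by ring
  rw [h1, sum_prob, ← dotProduct_meanFeature, dotProduct_featureCov_mulVec]
  ring

theorem posSemidef_featureCov (M : MNLModel S A d H) (h : ℕ) (s : S) (a : A)
    (θ : EuclideanSpace ℝ (Fin d)) : (M.featureCov h s a θ).PosSemidef := by
  refine PosSemidef.of_dotProduct_mulVec_nonneg (M.isHermitian_featureCov h s a θ) fun x => ?_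
  have := M.sum_prob_mul_sub_sq h s a θ x (x ⬝ᵥ (M.meanFeature h s a θ).ofLp)
  rw [sub_self, zero_pow two_ne_zero, add_zero] at this
  rw [star_trivial, ← this]
  exact Finset.sum_nonneg fun t _ => mul_nonneg (M.prob_nonneg h s a θ t) (sq_nonneg _)

/-- Holds for every outcome, so transitions to unreachable states need not be discarded as a null
event. -/
theorem posSemidef_featureCov_sub_hessian (M : MNLModel S A d H) (h : ℕ) (s : S) (a : A) (s' : S)
    (θ : EuclideanSpace ℝ (Fin d)) :
    (M.featureCov h s a θ - hessian (M.loss h s a s') θ).PosSemidef := by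
  by_cases hs' : s' ∈ M.reach h s a
  · rw [M.hessian_loss_of_mem hs', sub_self]
    exact PosSemidef.zero
  · rw [M.hessian_loss_of_notMem hs', sub_zero]
    exact M.posSemidef_featureCov h s a θ

theorem _root_.posSemidef_vecMulVec {n : Type*} [Fintype n] (v : n → ℝ) :
    (vecMulVec v v).PosSemidef := by
  simpa using posSemidef_vecMulVec_self_star v

/-- The mean outer product of the gradient at any `θ` dominates the covariance of the features
under the true parameter. -/
theorem posSemidef_sum_lossGrad_sub_featureCov (M : MNLModel S A d H) (h : ℕ) (s : S) (a : A)
    (θ θ' : EuclideanSpace ℝ (Fin d)) :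
    (∑ t, M.prob h s a θ' t •
      vecMulVec (M.lossGrad h s a t θ).ofLp (M.lossGrad h s a t θ).ofLp -
      M.featureCov h s a θ').PosSemidef := by
  refine PosSemidef.of_dotProduct_mulVec_nonneg (IsHermitian.sub ?_
    (M.isHermitian_featureCov h s a θ')) fun x => ?_
  · exact (posSemidef_sum _ fun t _ =>
      (posSemidef_vecMulVec (M.lossGrad h s a t θ).ofLp).smul
        (M.prob_nonneg h s a θ' t)).isHermitian
  · have := M.sum_prob_mul_sub_sq h s a θ' x (x ⬝ᵥ (M.meanFeature h s a θ).ofLp)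
    have e : ∑ t, M.prob h s a θ' t * (x ⬝ᵥ (M.lossGrad h s a t θ).ofLp) ^ 2 =
        ∑ t, M.prob h s a θ' t *
          (x ⬝ᵥ (M.meanFeature h s a θ).ofLp - x ⬝ᵥ (M.feature s a t).ofLp) ^ 2 := by
      refine Finset.sum_congr rfl fun t _ => ?_
      by_cases ht : t ∈ M.reach h s a
      · rw [lossGrad, if_pos ht, WithLp.ofLp_sub, dotProduct_sub]
      · rw [M.prob_of_notMem ht, zero_mul, zero_mul]
    rw [star_trivial, sub_mulVec, dotProduct_sub, sum_mulVec, dotProduct_sum]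
    simp only [smul_mulVec, dotProduct_smul, dotProduct_vecMulVec_mulVec, smul_eq_mul]
    rw [e, this]
    nlinarith [sq_nonneg (x ⬝ᵥ (M.meanFeature h s a θ).ofLp -
      x ⬝ᵥ (M.meanFeature h s a θ').ofLp)]

/-- This is the Cauchy-Schwarz inequality. -/
theorem _root_.posSemidef_one_sub_smul_vecMulVec {n : Type*} [Fintype n] [DecidableEq n]
    (v : EuclideanSpace ℝ n) {r : ℝ} (hr : 0 < r) (hv : ‖v‖ ^ 2 ≤ r) :
    (1 - r⁻¹ • vecMulVec v.ofLp v.ofLp).PosSemidef := by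
  refine PosSemidef.of_dotProduct_mulVec_nonneg (isHermitian_one.sub
    ((posSemidef_vecMulVec v.ofLp).smul (inv_pos.mpr hr).le).isHermitian) fun x => ?_
  rw [star_trivial, sub_mulVec, dotProduct_sub, one_mulVec, smul_mulVec, dotProduct_smul,
    dotProduct_vecMulVec_mulVec, smul_eq_mul, sub_nonneg, inv_mul_le_iff₀ hr]
  have h1 : x ⬝ᵥ v.ofLp = inner ℝ v (WithLp.toLp 2 x) := by
    simp [PiLp.inner_apply, dotProduct]
  have h2 : x ⬝ᵥ x = ‖WithLp.toLp 2 x‖ ^ 2 := by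
    rw [EuclideanSpace.real_norm_sq_eq]
    simp [dotProduct, sq]
  have h3 := abs_real_inner_le_norm v (WithLp.toLp 2 x)
  rw [h1, h2, ← sq_abs]
  calc |inner ℝ v (WithLp.toLp 2 x)| ^ 2 ≤ (‖v‖ * ‖WithLp.toLp 2 x‖) ^ 2 := by gcongr
    _ = ‖v‖ ^ 2 * ‖WithLp.toLp 2 x‖ ^ 2 := by ring
    _ ≤ _ := by gcongr

end MNLModel

/-! ### Measurability of the estimates with respect to the past -/

section Measurability

open Matrix Topology

variable {Ω : Type*} {mΩ : MeasurableSpace Ω}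

/-- A unique minimizer over a compact set depends measurably on the parameter. -/
theorem measurable_of_isMinOn {E : Type*} [TopologicalSpace E] [TopologicalSpace.MetrizableSpace E]
    [SecondCountableTopology E] [MeasurableSpace E] [BorelSpace E] {C : Set E} (hC : IsCompact C)
    {f : Ω → E → ℝ} (hfc : ∀ ω, Continuous (f ω)) (hfm : ∀ x, Measurable fun ω => f ω x)
    {θ : Ω → E} (hθC : ∀ ω, θ ω ∈ C) (hθ : ∀ ω, IsMinOn (f ω) C (θ ω))
    (huniq : ∀ ω, ∀ y ∈ C, IsMinOn (f ω) C y → y = θ ω) : Measurable θ := by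
  refine measurable_of_isClosed fun F hF => ?_
  obtain ⟨D, hDC, hD, hCD⟩ :=
    (TopologicalSpace.IsSeparable.of_separableSpace C).exists_countable_dense_subset
  obtain ⟨D', hDC', hD', hCD'⟩ :=
    (TopologicalSpace.IsSeparable.of_separableSpace (C ∩ F)).exists_countable_dense_subset
  -- The minimizer lies in `F` exactly when points of `F ∩ C` come arbitrarily close to the minimum
  -- over `C`. By continuity this can be tested on countable dense subsets.
  have key : θ ⁻¹' F = ⋂ n : ℕ, ⋃ x ∈ D', ⋂ y ∈ D, {ω | f ω x < f ω y + 1 / ((n : ℝ) + 1)} := by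
    ext ω
    simp only [Set.mem_preimage, Set.mem_iInter, Set.mem_iUnion, Set.mem_ofPred_eq, exists_prop]
    constructor
    · intro h n
      have hn : 0 < 1 / ((n : ℝ) + 1) := Nat.one_div_pos_of_nat
      have hcl := hCD' ⟨hθC ω, h⟩
      have hopen : IsOpen {x | f ω x < f ω (θ ω) + 1 / ((n : ℝ) + 1)} :=
        isOpen_lt (hfc ω) continuous_const
      obtain ⟨x, hx, hxD⟩ := mem_closure_iff.mp hcl _ hopen (by simpa using hn)
      exact ⟨x, hxD, fun y hy => lt_of_lt_of_le hx (by gcongr; exact hθ ω (hDC hy))⟩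
    · intro h
      obtain ⟨x₀, hx₀, -⟩ := h 0
      -- Compactness of `C ∩ F` turns near-minimizers into a minimizer in `F`; uniqueness identifies
      -- it with `θ ω`.
      obtain ⟨x, hx, hmin⟩ := (hC.inter_right hF).exists_isMinOn ⟨x₀, hDC' hx₀⟩
        (hfc ω).continuousOn
      have hle : f ω x ≤ f ω (θ ω) := by
        refine le_of_forall_pos_lt_add fun e he => ?_
        obtain ⟨n, hn⟩ := exists_nat_one_div_lt (half_pos he)
        obtain ⟨z, hz, hzD⟩ := h n
        have hopen : IsOpen {y | f ω y < f ω (θ ω) + e / 2} :=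
          isOpen_lt (hfc ω) continuous_const
        obtain ⟨y, hy, hyD⟩ := mem_closure_iff.mp (hCD (hθC ω)) _ hopen
          (by simpa using half_pos he)
        have h1 := hzD y hyD
        have h2 : f ω x ≤ f ω z := hmin (hDC' hz)
        have h3 : f ω y < f ω (θ ω) + e / 2 := hy
        linarith
      rw [← huniq ω x hx.1 fun y hy => hle.trans (hθ ω hy)]
      exact hx.2
  rw [key]
  refine MeasurableSet.iInter fun n => MeasurableSet.biUnion hD' fun x _ =>
    MeasurableSet.biInter hD fun y _ => ?_
  exact measurableSet_lt (hfm x) ((hfm y).add_const _)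

theorem measurable_det_of_entries {n : Type*} [Fintype n] [DecidableEq n] {A : Ω → Matrix n n ℝ}
    (hA : ∀ i j, Measurable fun ω => A ω i j) : Measurable fun ω => (A ω).det := by
  simp only [det_apply']
  exact Finset.measurable_fun_sum _ fun σ _ =>
    (Finset.measurable_fun_prod _ fun i _ => hA _ _).const_mul _

/-- By Cramer's rule the entries are quotients of determinants. The default inverse at determinant
zero is harmless, since inversion of reals is measurable everywhere. -/
theorem measurable_inv_entries {n : Type*} [Fintype n] [DecidableEq n] {A : Ω → Matrix n n ℝ}
    (hA : ∀ i j, Measurable fun ω => A ω i j) (i j : n) :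
    Measurable fun ω => (A ω)⁻¹ i j := by
  simp only [inv_def, Matrix.smul_apply, smul_eq_mul, Ring.inverse_eq_inv', adjugate_apply]
  refine (measurable_det_of_entries hA).inv.mul (measurable_det_of_entries fun k l => ?_)
  by_cases hk : k = j
  · subst hk
    simp only [updateRow_self]
    exact measurable_const
  · simp only [updateRow_ne hk]
    exact hA k l

theorem measurable_trace_exp_of_entries {n : Type*} [Fintype n] [DecidableEq n]
    {A : Ω → Matrix n n ℝ} (hA : ∀ i j, Measurable fun ω => A ω i j) :
    Measurable fun ω => (NormedSpace.exp (A ω)).trace := by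
  have h1 : Continuous fun B : n → n → ℝ => (NormedSpace.exp (Matrix.of B)).trace :=
    continuous_trace_exp.comp continuous_id
  exact h1.measurable.comp (measurable_pi_lambda _ fun i => measurable_pi_lambda _ fun j => hA i j)

theorem measurable_euclidean_of_apply {n : Type*} [Fintype n] {x : Ω → EuclideanSpace ℝ n}
    (hx : ∀ i, Measurable fun ω => x ω i) : Measurable x :=
  (WithLp.measurable_toLp 2 _).comp (measurable_pi_lambda _ hx)

theorem measurable_euclidean_apply {n : Type*} [Fintype n] {x : Ω → EuclideanSpace ℝ n}
    (hx : Measurable x) (i : n) : Measurable fun ω => x ω i :=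
  (measurable_pi_apply i).comp ((WithLp.measurable_ofLp 2 _).comp hx)

variable {S A : Type*} [Fintype S] [DecidableEq S] [MeasurableSpace A] {d H : ℕ}

theorem MNLModel.measurable_prob (M : MNLModel S A d H) (h : ℕ) (s s' : S)
    {α : Ω → A} (hα : Measurable α) {θ : Ω → EuclideanSpace ℝ (Fin d)} (hθ : Measurable θ) :
    Measurable fun ω => M.prob h s (α ω) (θ ω) s' := by
  have hexp (t : S) : Measurable fun ω => Real.exp ((M.Φ s (α ω)).mulVec (θ ω).ofLp t) := by
    simp only [mulVec, dotProduct]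
    exact (Finset.measurable_fun_sum _ fun i _ =>
      ((M.measurable_Φ s t i).comp hα).mul (measurable_euclidean_apply hθ i)).exp
  have hset (t : S) : MeasurableSet {ω | t ∈ M.reach h s (α ω)} :=
    hα (M.measurableSet_reach h s t)
  have hsum (ω : Ω) : ∑ t ∈ M.reach h s (α ω),
      Real.exp ((M.Φ s (α ω)).mulVec (θ ω).ofLp t) = ∑ t, if t ∈ M.reach h s (α ω) then
        Real.exp ((M.Φ s (α ω)).mulVec (θ ω).ofLp t) else 0 := by
    rw [Finset.sum_ite_mem, Finset.univ_inter]
  simp only [MNLModel.prob, hsum]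
  exact Measurable.ite (hset s') ((hexp s').div (Finset.measurable_fun_sum _ fun t _ =>
    Measurable.ite (hset t) (hexp t) measurable_const)) measurable_const

variable [MeasurableSpace S] [MeasurableSingletonClass S]

omit [DecidableEq S] in
/-- A function of finitely many states and further variables is measurable if it is so for
fixed states. -/
theorem measurable_of_fixed_states {E : Type*} [MeasurableSpace E] {f : S → Ω → E} {σ : Ω → S}
    (hσ : Measurable σ) (hf : ∀ x, Measurable (f x)) : Measurable fun ω => f (σ ω) ω :=
  (measurable_from_prod_countable_right (f := fun p : S × Ω => f p.1 p.2) hf).comp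
    (hσ.prodMk measurable_id)

theorem MNLModel.measurable_meanFeature (M : MNLModel S A d H) (h : ℕ) {σ : Ω → S}
    (hσ : Measurable σ) {α : Ω → A} (hα : Measurable α)
    {θ : Ω → EuclideanSpace ℝ (Fin d)} (hθ : Measurable θ) :
    Measurable fun ω => M.meanFeature h (σ ω) (α ω) (θ ω) := by
  refine measurable_of_fixed_states (f := fun x ω => M.meanFeature h x (α ω) (θ ω)) hσ fun x => ?_
  refine measurable_euclidean_of_apply fun i => ?_
  simp only [MNLModel.meanFeature, WithLp.ofLp_sum, Finset.sum_apply, PiLp.smul_apply, smul_eq_mul]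
  exact Finset.measurable_fun_sum _ fun t _ =>
    (M.measurable_prob h x t hα hθ).mul ((M.measurable_Φ x t i).comp hα)

theorem MNLModel.measurable_lossGrad (M : MNLModel S A d H) (h : ℕ) {σ σ' : Ω → S}
    (hσ : Measurable σ) (hσ' : Measurable σ') {α : Ω → A} (hα : Measurable α)
    {θ : Ω → EuclideanSpace ℝ (Fin d)} (hθ : Measurable θ) :
    Measurable fun ω => M.lossGrad h (σ ω) (α ω) (σ' ω) (θ ω) := by
  refine measurable_of_fixed_states (f := fun x ω => M.lossGrad h x (α ω) (σ' ω) (θ ω)) hσ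
    fun x => ?_
  refine measurable_of_fixed_states (f := fun y ω => M.lossGrad h x (α ω) y (θ ω)) hσ'
    fun y => ?_
  refine Measurable.ite (hα (M.measurableSet_reach h x y)) ?_ measurable_const
  refine (M.measurable_meanFeature h measurable_const hα hθ).sub ?_
  exact measurable_euclidean_of_apply fun i => (M.measurable_Φ x y i).comp hα

theorem MNLModel.measurable_featureCov (M : MNLModel S A d H) (h : ℕ) {σ : Ω → S}
    (hσ : Measurable σ) {α : Ω → A} (hα : Measurable α) (θ : EuclideanSpace ℝ (Fin d))
    (i j : Fin d) : Measurable fun ω => M.featureCov h (σ ω) (α ω) θ i j := by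
  refine measurable_of_fixed_states (f := fun x ω => M.featureCov h x (α ω) θ i j) hσ fun x => ?_
  have h1 := M.measurable_meanFeature h (measurable_const (a := x)) hα
    (measurable_const (a := θ))
  simp only [MNLModel.featureCov_apply]
  refine Measurable.sub (Finset.measurable_fun_sum _ fun t _ => ?_)
    ((measurable_euclidean_apply h1 i).mul (measurable_euclidean_apply h1 j))
  exact (M.measurable_prob h x t hα measurable_const).mul
    (((M.measurable_Φ x t i).comp hα).mul ((M.measurable_Φ x t j).comp hα))

theorem posDef_infoMatrix {ε : ℝ} (hε : 0 < ε) (f : ℕ → EuclideanSpace ℝ (Fin d) → ℝ)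
    (θ : ℕ → EuclideanSpace ℝ (Fin d)) (k : ℕ) : (infoMatrix ε f θ k).PosDef :=
  Matrix.PosDef.posSemidef_add (posSemidef_sum _ fun _ _ => posSemidef_vecMulVec _)
    (PosDef.one.smul hε)

/-- The minimizer of a positive definite quadratic form over a convex set is unique. -/
theorem eq_of_isMinOn_quadratic {Q : Matrix (Fin d) (Fin d) ℝ} (hQ : Q.PosDef)
    (z : EuclideanSpace ℝ (Fin d)) {C : Set (EuclideanSpace ℝ (Fin d))} (hC : Convex ℝ C)
    {x y : EuclideanSpace ℝ (Fin d)} (hx : x ∈ C) (hy : y ∈ C)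
    (hxm : IsMinOn (fun x => (x - z).ofLp ⬝ᵥ Q.mulVec (x - z).ofLp) C x)
    (hym : IsMinOn (fun x => (x - z).ofLp ⬝ᵥ Q.mulVec (x - z).ofLp) C y) : x = y := by
  by_contra hne
  have hpos := hQ.dotProduct_mulVec_pos (x := (x - y).ofLp) fun h0 =>
    hne (sub_eq_zero.mp (WithLp.ofLp_injective 2 h0))
  -- By the parallelogram identity, the form at the midpoint is the mean of the two values minus a
  -- quarter of the form at `x - y`, so distinct minimizers would be beaten.
  have hmid : (2⁻¹ : ℝ) • x + (2⁻¹ : ℝ) • y ∈ C := hC hx hy (by norm_num) (by norm_num)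
    (by norm_num)
  have h1 := hxm hmid
  have h2 := hym hmid
  simp only [star_trivial, Set.mem_ofPred_eq] at hpos h1 h2
  have e : ((2⁻¹ : ℝ) • x + (2⁻¹ : ℝ) • y - z) = (2⁻¹ : ℝ) • ((x - z) + (y - z)) := by
    module
  have e' : x - y = (x - z) - (y - z) := by abel
  rw [e] at h1 h2
  rw [e'] at hpos
  generalize x - z = u at *
  generalize y - z = v at *
  simp only [WithLp.ofLp_sub, WithLp.ofLp_add, WithLp.ofLp_smul, mulVec_sub, mulVec_add,
    mulVec_smul, dotProduct_sub, sub_dotProduct, dotProduct_add, add_dotProduct, dotProduct_smul,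
    smul_dotProduct, smul_eq_mul] at hpos h1 h2
  linarith

theorem measurable_infoMatrix {ε : ℝ} {f : Ω → ℕ → EuclideanSpace ℝ (Fin d) → ℝ}
    {θ : Ω → ℕ → EuclideanSpace ℝ (Fin d)} {k : ℕ}
    (hg : ∀ ν ∈ Finset.Icc 1 k, Measurable fun ω => gradient (f ω ν) (θ ω (ν - 1)))
    (i j : Fin d) : Measurable fun ω => infoMatrix ε (f ω) (θ ω) k i j := by
  simp only [infoMatrix, Matrix.add_apply, Matrix.sum_apply, vecMulVec_apply]
  exact (Finset.measurable_fun_sum _ fun ν hν => (measurable_euclidean_apply (hg ν hν) i).mul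
    (measurable_euclidean_apply (hg ν hν) j)).add_const _

theorem measurable_newtonStep {η ε : ℝ} {f : Ω → ℕ → EuclideanSpace ℝ (Fin d) → ℝ}
    {θ : Ω → ℕ → EuclideanSpace ℝ (Fin d)} {k : ℕ} (hk : 1 ≤ k)
    (hg : ∀ ν ∈ Finset.Icc 1 k, Measurable fun ω => gradient (f ω ν) (θ ω (ν - 1)))
    (hθ : Measurable fun ω => θ ω (k - 1)) :
    Measurable fun ω => newtonStep η ε (f ω) (θ ω) k := by
  refine measurable_euclidean_of_apply fun i => ?_
  simp only [newtonStep, PiLp.sub_apply, PiLp.smul_apply, smul_eq_mul, mulVec, dotProduct]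
  exact (measurable_euclidean_apply hθ i).sub (Measurable.const_mul
    (Finset.measurable_fun_sum _ fun j _ => (measurable_inv_entries (measurable_infoMatrix hg) i j).mul
      (measurable_euclidean_apply (hg k (Finset.right_mem_Icc.mpr hk)) j)) η)

theorem measurable_projection {η ε B : ℝ} (hε : 0 < ε)
    {f : Ω → ℕ → EuclideanSpace ℝ (Fin d) → ℝ}
    {θ : Ω → ℕ → EuclideanSpace ℝ (Fin d)} {k : ℕ} (hk : 1 ≤ k)
    (hg : ∀ ν ∈ Finset.Icc 1 k, Measurable fun ω => gradient (f ω ν) (θ ω (ν - 1)))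
    (hθ : Measurable fun ω => θ ω (k - 1))
    (hmem : ∀ ω, θ ω k ∈ Metric.closedBall 0 B)
    (hmin : ∀ ω, IsMinOn (fun x => (x - newtonStep η ε (f ω) (θ ω) k).ofLp ⬝ᵥ
        (infoMatrix ε (f ω) (θ ω) k).mulVec (x - newtonStep η ε (f ω) (θ ω) k).ofLp)
      (Metric.closedBall 0 B) (θ ω k)) :
    Measurable fun ω => θ ω k := by
  refine measurable_of_isMinOn (isCompact_closedBall 0 B) (f := fun ω x =>
    (x - newtonStep η ε (f ω) (θ ω) k).ofLp ⬝ᵥ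
        (infoMatrix ε (f ω) (θ ω) k).mulVec (x - newtonStep η ε (f ω) (θ ω) k).ofLp)
    (fun ω => ?_) (fun x => ?_) hmem hmin fun ω y hy hym =>
    eq_of_isMinOn_quadratic (posDef_infoMatrix hε _ _ k) _ (convex_closedBall 0 B) hy (hmem ω)
      hym (hmin ω)
  · simp only [mulVec, dotProduct]
    fun_prop
  · have h1 (i : Fin d) : Measurable fun ω => (x - newtonStep η ε (f ω) (θ ω) k).ofLp i :=
      measurable_euclidean_apply (measurable_const.sub (measurable_newtonStep hk hg hθ)) i
    simp only [mulVec, dotProduct]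
    exact Finset.measurable_fun_sum _ fun i _ => (h1 i).mul
      (Finset.measurable_fun_sum _ fun j _ => (measurable_infoMatrix hg i j).mul (h1 j))

/-- The estimates are measurable with respect to every `σ`-algebra that makes the observed
transitions measurable. -/
theorem measurable_estimate (M : MNLModel S A d H) {s : ℕ → ℕ → Ω → S} {a : ℕ → ℕ → Ω → A}
    {η ε : ℝ} (hε : 0 < ε) {h K : ℕ} {θ : Ω → ℕ → EuclideanSpace ℝ (Fin d)}
    (hθ : (∀ ω, IsONS η ε K (episodeLoss M s a h ω) (θ ω)) ∨
      (∀ ω, IsProjectedONS η ε M.Bθ K (episodeLoss M s a h ω) (θ ω)))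
    {k : ℕ} (hk : k ≤ K) (hs : ∀ ν ∈ Finset.Icc 1 k, Measurable (s ν h))
    (ha : ∀ ν ∈ Finset.Icc 1 k, Measurable (a ν h))
    (hs' : ∀ ν ∈ Finset.Icc 1 k, Measurable (s ν (h + 1))) :
    ∀ j ≤ k, Measurable fun ω => θ ω j := by
  intro j
  -- Strong induction is needed because the information matrix involves all earlier estimates.
  induction j using Nat.strong_induction_on with
  | _ j ih =>
    intro hj
    rcases Nat.eq_zero_or_pos j with rfl | hj0
    · have h0 (ω : Ω) : θ ω 0 = 0 := by
        rcases hθ with h1 | h1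
        · exact (h1 ω).1
        · exact (h1 ω).1
      simp only [h0]
      exact measurable_const
    · have hjK : j ∈ Finset.Icc 1 K := Finset.mem_Icc.mpr ⟨hj0, hj.trans hk⟩
      have hg : ∀ ν ∈ Finset.Icc 1 j,
          Measurable fun ω => gradient (episodeLoss M s a h ω ν) (θ ω (ν - 1)) := by
        intro ν hν
        obtain ⟨hν1, hνj⟩ := Finset.mem_Icc.mp hν
        have hνk : ν ∈ Finset.Icc 1 k := Finset.mem_Icc.mpr ⟨hν1, hνj.trans hj⟩
        simp only [episodeLoss, MNLModel.gradient_loss]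
        exact M.measurable_lossGrad h (hs ν hνk) (hs' ν hνk) (ha ν hνk)
          (ih (ν - 1) (by omega) (by omega))
      have hprev := ih (j - 1) (by omega) (by omega)
      rcases hθ with h1 | h1
      · simp only [fun ω => (h1 ω).2 j hjK]
        exact measurable_newtonStep hj0 hg hprev
      · exact measurable_projection hε hj0 hg hprev (fun ω => ((h1 ω).2 j hjK).1)
          fun ω => ((h1 ω).2 j hjK).2

end Measurability

/-! ### A maximal inequality for stopped supermartingales -/

section Maximal

open ENNReal

variable {Ω : Type*} {m0 : MeasurableSpace Ω} {μ : Measure Ω}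

/-- The maximal inequality for nonnegative processes that are supermartingales until they reach
the level `r`. -/
theorem mul_measure_compl_add_setLIntegral_le {K : ℕ} {Z : ℕ → Ω → ℝ≥0∞} {r : ℝ≥0∞}
    (hZ : ∀ k ≤ K, Measurable (Z k))
    (hstep : ∀ k < K, ∫⁻ ω in {ω | ∀ j ≤ k, Z j ω < r}, Z (k + 1) ω ∂μ ≤
      ∫⁻ ω in {ω | ∀ j ≤ k, Z j ω < r}, Z k ω ∂μ) :
    ∀ k ≤ K, r * μ {ω | ∀ j ≤ k, Z j ω < r}ᶜ + ∫⁻ ω in {ω | ∀ j ≤ k, Z j ω < r}, Z k ω ∂μ ≤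
      ∫⁻ ω, Z 0 ω ∂μ := by
  have hmeas : ∀ k ≤ K, MeasurableSet {ω | ∀ j ≤ k, Z j ω < r} := fun k hk => by
    have : {ω | ∀ j ≤ k, Z j ω < r} = ⋂ j ∈ Set.Iic k, {ω | Z j ω < r} := by
      ext ω; simp
    rw [this]
    exact MeasurableSet.biInter (Set.to_countable _) fun j hj =>
      measurableSet_lt (hZ j (le_trans hj hk)) measurable_const
  intro k
  induction k with
  | zero =>
    intro hk
    rw [← lintegral_add_compl (μ := μ) (fun ω => Z 0 ω) (hmeas 0 hk), add_comm (r * _)]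
    refine add_le_add le_rfl ?_
    rw [← setLIntegral_const]
    refine setLIntegral_mono (hZ 0 hk) fun ω hω => ?_
    simpa using hω
  | succ k ih =>
    intro hk
    set B := {ω | ∀ j ≤ k, Z j ω < r} with hB
    set C := {ω | ∀ j ≤ k + 1, Z j ω < r} with hC
    have hBm := hmeas k (by omega)
    have hCm := hmeas (k + 1) hk
    have hCB : C ⊆ B := fun ω hω j hj => hω j (by omega)
    have hcompl : Cᶜ = Bᶜ ∪ (B \ C) := by
      ext ω
      have := @hCB ω
      simp only [Set.mem_compl_iff, Set.mem_union, Set.mem_sdiff]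
      tauto
    -- On `B \ C` the level is reached for the first time at `k + 1`; this mass moves from the
    -- integral to the probability term.
    have h1 : r * μ (B \ C) ≤ ∫⁻ ω in B \ C, Z (k + 1) ω ∂μ := by
      rw [← setLIntegral_const]
      refine setLIntegral_mono (hZ _ hk) fun ω hω => ?_
      by_contra hlt
      refine hω.2 fun j hj => ?_
      rcases Nat.lt_or_ge j (k + 1) with hj' | hj'
      · exact hω.1 j (by omega)
      · obtain rfl : j = k + 1 := by omega
        exact not_le.mp hlt
    have h2 : ∫⁻ ω in B, Z (k + 1) ω ∂μ =
        ∫⁻ ω in C, Z (k + 1) ω ∂μ + ∫⁻ ω in B \ C, Z (k + 1) ω ∂μ := by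
      rw [← lintegral_union (hBm.diff hCm) Set.disjoint_sdiff_right, Set.union_sdiff_cancel hCB]
    calc r * μ Cᶜ + ∫⁻ ω in C, Z (k + 1) ω ∂μ
        ≤ r * (μ Bᶜ + μ (B \ C)) + ∫⁻ ω in C, Z (k + 1) ω ∂μ := by
          rw [hcompl]
          gcongr
          exact measure_union_le _ _
      _ = r * μ Bᶜ + (∫⁻ ω in C, Z (k + 1) ω ∂μ + r * μ (B \ C)) := by ring
      _ ≤ r * μ Bᶜ + ∫⁻ ω in B, Z (k + 1) ω ∂μ := by
          rw [h2]; gcongr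
      _ ≤ r * μ Bᶜ + ∫⁻ ω in B, Z k ω ∂μ :=
          add_le_add le_rfl (hstep k (by omega))
      _ ≤ _ := ih (by omega)

end Maximal

/-! ### Conditional probabilities and integrals of nonnegative functions -/

section CondProb

variable {Ω : Type*} {m m0 : MeasurableSpace Ω} {μ : Measure Ω}

/-- The defining property of conditional probabilities, for nonnegative functions. -/
theorem setLIntegral_eq_lintegral_mul_condProb [IsProbabilityMeasure μ]
    (hm : m ≤ m0) {B : Set Ω} (hB : MeasurableSet B) {p : Ω → ℝ} (hp0 : ∀ ω, 0 ≤ p ω)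
    (hpm : Measurable[m] p)
    (hp : μ[B.indicator (fun _ => (1 : ℝ)) | m] =ᵐ[μ] p) {F : Ω → ENNReal} (hF : Measurable[m] F) :
    ∫⁻ ω in B, F ω ∂μ = ∫⁻ ω, F ω * ENNReal.ofReal (p ω) ∂μ := by
  have hint : Integrable (B.indicator (fun _ => (1 : ℝ))) μ := (integrable_const 1).indicator hB
  have hpm0 : Measurable p := hpm.mono hm le_rfl
  -- Restriction to `B` and the density `p` define measures that agree on `m`, hence have equal
  -- integrals of all `m`-measurable functions, with no integrability assumption on `F`.
  have htrim : (μ.restrict B).trim hm = (μ.withDensity fun ω => ENNReal.ofReal (p ω)).trim hm := by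
    refine @Measure.ext _ m _ _ fun E hE => ?_
    rw [trim_measurableSet_eq hm hE, trim_measurableSet_eq hm hE, Measure.restrict_apply (hm _ hE),
      withDensity_apply _ (hm _ hE)]
    have h1 := setIntegral_condExp hm hint hE
    rw [setIntegral_congr_ae (hm _ hE) (hp.mono fun ω hω _ => hω), integral_indicator hB,
      Measure.restrict_restrict hB, setIntegral_const, smul_eq_mul, mul_one] at h1
    rw [← ofReal_integral_eq_lintegral_ofReal (integrable_condExp.congr hp).integrableOn
      (ae_of_all _ hp0), h1, ofReal_measureReal, Set.inter_comm]
  calc ∫⁻ ω in B, F ω ∂μ = ∫⁻ ω, F ω ∂(μ.restrict B).trim hm := (lintegral_trim hm hF).symm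
    _ = ∫⁻ ω, F ω ∂(μ.withDensity fun ω => ENNReal.ofReal (p ω)) := by
        rw [htrim, lintegral_trim hm hF]
    _ = _ := by
        rw [lintegral_withDensity_eq_lintegral_mul _ hpm0.ennreal_ofReal (hF.mono hm le_rfl)]
        exact lintegral_congr fun ω => mul_comm _ _

end CondProb

/-! ### The trace exponential supermartingale of the interaction -/

section Interaction

open Matrix

variable {Ω S A : Type*} [mΩ : MeasurableSpace Ω] [Fintype S] [DecidableEq S] [MeasurableSpace S]
  [MeasurableSpace A] {d H K : ℕ} {μ : Measure Ω} {M : MNLModel S A d H}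
  {s : ℕ → ℕ → Ω → S} {a : ℕ → ℕ → Ω → A}

omit mΩ [Fintype S] [DecidableEq S] in
theorem measurable_state_history_of_lt {k ν h h' : ℕ} (hν : ν ∈ Finset.Ico 1 k)
    (hh' : h' ∈ Finset.Icc 1 (H + 1)) : Measurable[history H s a k h] (s ν h') := by
  rw [measurable_iff_comap_le]
  refine le_sup_of_le_left (le_sup_of_le_left (le_sup_of_le_left ?_))
  exact le_iSup₂_of_le ν hν (le_iSup₂_of_le h' hh' le_rfl)

omit mΩ [Fintype S] [DecidableEq S] in
theorem measurable_action_history_of_lt {k ν h h' : ℕ} (hν : ν ∈ Finset.Ico 1 k)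
    (hh' : h' ∈ Finset.Icc 1 H) : Measurable[history H s a k h] (a ν h') := by
  rw [measurable_iff_comap_le]
  refine le_sup_of_le_left (le_sup_of_le_left (le_sup_of_le_right ?_))
  exact le_iSup₂_of_le ν hν (le_iSup₂_of_le h' hh' le_rfl)

omit mΩ [Fintype S] [DecidableEq S] in
theorem measurable_state_history {k h : ℕ} (hh : 1 ≤ h) :
    Measurable[history H s a k h] (s k h) := by
  rw [measurable_iff_comap_le]
  refine le_sup_of_le_left (le_sup_of_le_right ?_)
  exact le_iSup₂_of_le h (Finset.right_mem_Icc.mpr hh) le_rfl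

omit mΩ [Fintype S] [DecidableEq S] in
theorem measurable_action_history {k h : ℕ} (hh : 1 ≤ h) :
    Measurable[history H s a k h] (a k h) := by
  rw [measurable_iff_comap_le]
  refine le_sup_of_le_right ?_
  exact le_iSup₂_of_le h (Finset.right_mem_Icc.mpr hh) le_rfl

theorem IsInteraction.history_le (hsa : IsInteraction M K s a μ) {k h : ℕ}
    (hk : k ∈ Finset.Icc 1 K) (hh : h ∈ Finset.Icc 1 H) : history H s a k h ≤ mΩ := by
  rw [Finset.mem_Icc] at hk hh
  refine sup_le (sup_le (sup_le ?_ ?_) ?_) ?_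
  · refine iSup₂_le fun ν hν => iSup₂_le fun h' hh' => ?_
    rw [Finset.mem_Ico] at hν
    exact (hsa.measurable_state ν (Finset.mem_Icc.mpr ⟨hν.1, by omega⟩) h' hh').comap_le
  · refine iSup₂_le fun ν hν => iSup₂_le fun h' hh' => ?_
    rw [Finset.mem_Ico] at hν
    exact (hsa.measurable_action ν (Finset.mem_Icc.mpr ⟨hν.1, by omega⟩) h' hh').comap_le
  · refine iSup₂_le fun h' hh' => ?_
    rw [Finset.mem_Icc] at hh'
    exact (hsa.measurable_state k (Finset.mem_Icc.mpr hk) h'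
      (Finset.mem_Icc.mpr ⟨hh'.1, by omega⟩)).comap_le
  · refine iSup₂_le fun h' hh' => ?_
    rw [Finset.mem_Icc] at hh'
    exact (hsa.measurable_action k (Finset.mem_Icc.mpr hk) h'
      (Finset.mem_Icc.mpr ⟨hh'.1, by omega⟩)).comap_le

/-- The outer product of the gradient at `θ` for the observed transition `(x, b, y)`, normalized
to be at most the identity. -/
noncomputable def normalizedOuter (M : MNLModel S A d H) (h : ℕ) (x : S) (b : A) (y : S)
    (θ : EuclideanSpace ℝ (Fin d)) : Matrix (Fin d) (Fin d) ℝ :=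
  (4 * M.BΦ ^ 2)⁻¹ • vecMulVec (M.lossGrad h x b y θ).ofLp (M.lossGrad h x b y θ).ofLp

/-- The covariance of the features under the true parameter, with the normalization of
`normalizedOuter`. -/
noncomputable def normalizedCov (M : MNLModel S A d H) (h : ℕ) (x : S) (b : A) :
    Matrix (Fin d) (Fin d) ℝ :=
  (4 * M.BΦ ^ 2)⁻¹ • M.featureCov h x b (M.θstar h)

/-- The accumulated difference of the scaled conditional covariances and the outer products of
the gradients. -/
noncomputable def deviation (M : MNLModel S A d H) (s : ℕ → ℕ → Ω → S) (a : ℕ → ℕ → Ω → A) (h : ℕ)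
    (θ : Ω → ℕ → EuclideanSpace ℝ (Fin d)) (k : ℕ) (ω : Ω) : Matrix (Fin d) (Fin d) ℝ :=
  ∑ ν ∈ Finset.Icc 1 k, ((1 - Real.exp (-1)) • normalizedCov M h (s ν h ω) (a ν h ω) -
    normalizedOuter M h (s ν h ω) (a ν h ω) (s ν (h + 1) ω) (θ ω (ν - 1)))

omit mΩ [MeasurableSpace S] in
theorem deviation_succ (h : ℕ) (θ : Ω → ℕ → EuclideanSpace ℝ (Fin d)) (k : ℕ) (ω : Ω) :
    deviation M s a h θ (k + 1) ω = deviation M s a h θ k ω +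
      (1 - Real.exp (-1)) • normalizedCov M h (s (k + 1) h ω) (a (k + 1) h ω) -
      normalizedOuter M h (s (k + 1) h ω) (a (k + 1) h ω) (s (k + 1) (h + 1) ω) (θ ω k) := by
  rw [deviation, Finset.sum_Icc_succ_top (by omega), deviation, Nat.add_sub_cancel, add_sub_assoc]

omit [MeasurableSpace S] in
theorem posSemidef_normalizedOuter (M : MNLModel S A d H) (h : ℕ) (x : S) (b : A) (y : S)
    (θ : EuclideanSpace ℝ (Fin d)) : (normalizedOuter M h x b y θ).PosSemidef :=
  (posSemidef_vecMulVec _).smul (by positivity)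

omit [MeasurableSpace S] in
theorem posSemidef_one_sub_normalizedOuter (M : MNLModel S A d H) (hB : M.BΦ ≠ 0) (h : ℕ) (x : S)
    (b : A) (y : S) (θ : EuclideanSpace ℝ (Fin d)) :
    (1 - normalizedOuter M h x b y θ).PosSemidef := by
  refine posSemidef_one_sub_smul_vecMulVec _ (by positivity) ?_
  calc ‖M.lossGrad h x b y θ‖ ^ 2 ≤ (2 * M.BΦ) ^ 2 := by
        gcongr
        exact M.norm_lossGrad_le h x b y θ
    _ = 4 * M.BΦ ^ 2 := by ring

omit [MeasurableSpace S] in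
theorem isHermitian_normalizedCov (M : MNLModel S A d H) (h : ℕ) (x : S) (b : A) :
    (normalizedCov M h x b).IsHermitian :=
  (M.isHermitian_featureCov h x b _).smul (IsSelfAdjoint.all _)

omit mΩ [MeasurableSpace S] in
theorem isHermitian_deviation (h : ℕ) (θ : Ω → ℕ → EuclideanSpace ℝ (Fin d)) (k : ℕ) (ω : Ω) :
    (deviation M s a h θ k ω).IsHermitian := by
  induction k with
  | zero => simp [deviation]
  | succ k ih =>
    rw [deviation_succ]
    exact (ih.add ((isHermitian_normalizedCov M h _ _).smul (IsSelfAdjoint.all _))).sub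
      (posSemidef_normalizedOuter M h _ _ _ _).isHermitian

-- This is the one-step bound averaged over the next state: the mean of `normalizedOuter` under the
-- true transition law dominates `normalizedCov`.
omit [MeasurableSpace S] in
theorem sum_prob_mul_trace_exp_le (M : MNLModel S A d H) (hB : M.BΦ ≠ 0) (h : ℕ) (x : S) (b : A)
    (θ : EuclideanSpace ℝ (Fin d)) {Y : Matrix (Fin d) (Fin d) ℝ} (hY : Y.IsHermitian) :
    ∑ y, M.prob h x b (M.θstar h) y * (NormedSpace.exp (Y +
      (1 - Real.exp (-1)) • normalizedCov M h x b - normalizedOuter M h x b y θ)).trace ≤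
      (NormedSpace.exp Y).trace := by
  refine sum_trace_exp_le (M.prob_nonneg h x b _) (M.sum_prob h x b _) hY
    (isHermitian_normalizedCov M h x b) (fun y => posSemidef_normalizedOuter M h x b y θ)
    (fun y => posSemidef_one_sub_normalizedOuter M hB h x b y θ) ?_
  have h1 := (M.posSemidef_sum_lossGrad_sub_featureCov h x b θ (M.θstar h)).smul
    (show 0 ≤ (4 * M.BΦ ^ 2)⁻¹ by positivity)
  convert h1 using 1
  simp only [normalizedOuter, normalizedCov, smul_sub, Finset.smul_sum]
  congr 1
  exact Finset.sum_congr rfl fun y _ => smul_comm _ _ _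

variable [MeasurableSingletonClass S]

theorem measurable_normalizedOuter (M : MNLModel S A d H) (h : ℕ) {σ σ' : Ω → S}
    (hσ : Measurable σ) (hσ' : Measurable σ') {α : Ω → A} (hα : Measurable α)
    {θ : Ω → EuclideanSpace ℝ (Fin d)} (hθ : Measurable θ) (i j : Fin d) :
    Measurable fun ω => normalizedOuter M h (σ ω) (α ω) (σ' ω) (θ ω) i j := by
  have h1 := M.measurable_lossGrad h hσ hσ' hα hθ
  simp only [normalizedOuter, Matrix.smul_apply, vecMulVec_apply, smul_eq_mul]
  exact ((measurable_euclidean_apply h1 i).mul (measurable_euclidean_apply h1 j)).const_mul _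

theorem measurable_normalizedCov (M : MNLModel S A d H) (h : ℕ) {σ : Ω → S}
    (hσ : Measurable σ) {α : Ω → A} (hα : Measurable α) (i j : Fin d) :
    Measurable fun ω => normalizedCov M h (σ ω) (α ω) i j := by
  simp only [normalizedCov, Matrix.smul_apply, smul_eq_mul]
  exact (M.measurable_featureCov h hσ hα _ i j).const_mul _

theorem measurable_deviation {h k : ℕ} {θ : Ω → ℕ → EuclideanSpace ℝ (Fin d)}
    (hs : ∀ ν ∈ Finset.Icc 1 k, Measurable (s ν h))
    (ha : ∀ ν ∈ Finset.Icc 1 k, Measurable (a ν h))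
    (hs' : ∀ ν ∈ Finset.Icc 1 k, Measurable (s ν (h + 1)))
    (hθ : ∀ j ≤ k, Measurable fun ω => θ ω j) {l : ℕ} (hl : l ≤ k) (i j : Fin d) :
    Measurable fun ω => deviation M s a h θ l ω i j := by
  simp only [deviation, Matrix.sum_apply, Matrix.sub_apply, Matrix.smul_apply, smul_eq_mul]
  refine Finset.measurable_fun_sum _ fun ν hν => ?_
  rw [Finset.mem_Icc] at hν
  have hνk : ν ∈ Finset.Icc 1 k := Finset.mem_Icc.mpr ⟨hν.1, hν.2.trans hl⟩
  exact ((measurable_normalizedCov M h (hs ν hνk) (ha ν hνk) i j).const_mul _).sub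
    (measurable_normalizedOuter M h (hs ν hνk) (hs' ν hνk) (ha ν hνk) (hθ _ (by omega)) i j)

/-- The trace exponential of the deviation is a supermartingale. -/
theorem setLIntegral_trace_exp_deviation_succ_le [IsProbabilityMeasure μ]
    (hsa : IsInteraction M K s a μ) (hB : M.BΦ ≠ 0) {h : ℕ} (hh : h ∈ Finset.Icc 1 H)
    {θ : Ω → ℕ → EuclideanSpace ℝ (Fin d)} {k : ℕ} (hk : k < K)
    (hθ : ∀ j ≤ k, Measurable[history H s a (k + 1) h] fun ω => θ ω j)
    {G : Set Ω} (hG : MeasurableSet[history H s a (k + 1) h] G) :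
    ∫⁻ ω in G, ENNReal.ofReal (NormedSpace.exp (deviation M s a h θ (k + 1) ω)).trace ∂μ ≤
      ∫⁻ ω in G, ENNReal.ofReal (NormedSpace.exp (deviation M s a h θ k ω)).trace ∂μ := by
  have hk1 : k + 1 ∈ Finset.Icc 1 K := Finset.mem_Icc.mpr (by omega)
  have hh' := Finset.mem_Icc.mp hh
  have hm := hsa.history_le hk1 hh
  have hνIco : ∀ ν ∈ Finset.Icc 1 k, ν ∈ Finset.Ico 1 (k + 1) := fun ν hν => by
    rw [Finset.mem_Icc] at hν
    exact Finset.mem_Ico.mpr (by omega)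
  have hs1 : h ∈ Finset.Icc 1 (H + 1) := Finset.mem_Icc.mpr (by omega)
  have hs2 : h + 1 ∈ Finset.Icc 1 (H + 1) := Finset.mem_Icc.mpr (by omega)
  have hsm : Measurable[history H s a (k + 1) h] (s (k + 1) h) := measurable_state_history hh'.1
  have ham : Measurable[history H s a (k + 1) h] (a (k + 1) h) := measurable_action_history hh'.1
  have hs'm : Measurable (s (k + 1) (h + 1)) := hsa.measurable_state _ hk1 _ hs2
  -- `Q y` is the next trace exponential if the next state is `y`. It is known from the history, so
  -- the only fresh randomness is which `y` occurs.
  set Q : S → Ω → ℝ := fun y ω => (NormedSpace.exp (deviation M s a h θ k ω +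
      (1 - Real.exp (-1)) • normalizedCov M h (s (k + 1) h ω) (a (k + 1) h ω) -
      normalizedOuter M h (s (k + 1) h ω) (a (k + 1) h ω) y (θ ω k))).trace with hQ
  have hQm (y : S) : Measurable[history H s a (k + 1) h] (Q y) := by
    refine measurable_trace_exp_of_entries (mΩ := history H s a (k + 1) h) fun i j => ?_
    simp only [Matrix.add_apply, Matrix.sub_apply, Matrix.smul_apply, smul_eq_mul]
    exact ((measurable_deviation (mΩ := history H s a (k + 1) h)
        (fun ν hν => measurable_state_history_of_lt (hνIco ν hν) hs1)
        (fun ν hν => measurable_action_history_of_lt (hνIco ν hν) hh)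
        (fun ν hν => measurable_state_history_of_lt (hνIco ν hν) hs2) hθ le_rfl i j).add
      ((measurable_normalizedCov (mΩ := history H s a (k + 1) h) M h hsm ham i j).const_mul
        _)).sub
      (measurable_normalizedOuter (mΩ := history H s a (k + 1) h) M h hsm measurable_const ham
        (hθ k le_rfl) i j)
  set p : S → Ω → ℝ := fun y ω =>
    M.prob h (s (k + 1) h ω) (a (k + 1) h ω) (M.θstar h) y with hp
  have hpm (y : S) : Measurable[history H s a (k + 1) h] (p y) :=
    measurable_of_fixed_states (mΩ := history H s a (k + 1) h)
      (f := fun x ω => M.prob h x (a (k + 1) h ω) (M.θstar h) y) hsm fun x =>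
        M.measurable_prob (mΩ := history H s a (k + 1) h) h x y ham measurable_const
  have hfib (y : S) : MeasurableSet (s (k + 1) (h + 1) ⁻¹' {y}) :=
    hs'm (measurableSet_singleton y)
  have hsplit (ω : Ω) : ENNReal.ofReal (NormedSpace.exp (deviation M s a h θ (k + 1) ω)).trace =
      ∑ y, (s (k + 1) (h + 1) ⁻¹' {y}).indicator (fun ω => ENNReal.ofReal (Q y ω)) ω := by
    rw [Finset.sum_eq_single (s (k + 1) (h + 1) ω), Set.indicator_of_mem
      (Set.mem_preimage.mpr (Set.mem_singleton _)), deviation_succ]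
    · intro y _ hy
      exact Set.indicator_of_notMem (fun h0 => hy h0.symm) _
    · simp
  have hQm0 (y : S) : Measurable (Q y) := (hQm y).mono hm le_rfl
  have hpm0 (y : S) : Measurable (p y) := (hpm y).mono hm le_rfl
  have hstep (y : S) :
      ∫⁻ ω in G, (s (k + 1) (h + 1) ⁻¹' {y}).indicator (fun ω => ENNReal.ofReal (Q y ω)) ω ∂μ =
        ∫⁻ ω in G, ENNReal.ofReal (Q y ω) * ENNReal.ofReal (p y ω) ∂μ := by
    -- The event `G` belongs to the history, so its indicator can be absorbed into the integrand.
    have h1 := setLIntegral_eq_lintegral_mul_condProb hm (hfib y)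
      (fun ω => M.prob_nonneg h _ _ _ _) (hpm y) (hsa.transition _ hk1 _ hh y)
      (F := G.indicator fun ω => ENNReal.ofReal (Q y ω)) ((hQm y).ennreal_ofReal.indicator hG)
    rw [lintegral_indicator (hfib y), Measure.restrict_restrict (hfib y), Set.inter_comm,
      ← Measure.restrict_restrict (hm _ hG), ← lintegral_indicator (hm _ hG), h1,
      ← lintegral_indicator (hm _ hG)]
    refine lintegral_congr fun ω => ?_
    by_cases hω : ω ∈ G <;> simp [hω, hp]
  simp only [hsplit]
  rw [lintegral_finsetSum _ fun y _ => ((hQm0 y).ennreal_ofReal).indicator (hfib y),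
    Finset.sum_congr rfl fun y _ => hstep y,
    ← lintegral_finsetSum (f := fun y ω => ENNReal.ofReal (Q y ω) * ENNReal.ofReal (p y ω)) _
      fun y _ => (hQm0 y).ennreal_ofReal.mul (hpm0 y).ennreal_ofReal]
  refine lintegral_mono fun ω => ?_
  have hp0 (y : S) : 0 ≤ p y ω := M.prob_nonneg h _ _ _ _
  have hQ0 (y : S) : 0 ≤ Q y ω := by
    refine (posDef_exp ?_).posSemidef.trace_nonneg
    exact ((isHermitian_deviation h θ k ω).add ((isHermitian_normalizedCov M h _ _).smul
      (IsSelfAdjoint.all _))).sub (posSemidef_normalizedOuter M h _ _ _ _).isHermitian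
  calc ∑ y, ENNReal.ofReal (Q y ω) * ENNReal.ofReal (p y ω)
      = ENNReal.ofReal (∑ y, p y ω * Q y ω) := by
        rw [ENNReal.ofReal_sum_of_nonneg fun y _ => mul_nonneg (hp0 y) (hQ0 y)]
        refine Finset.sum_congr rfl fun y _ => ?_
        rw [ENNReal.ofReal_mul (hp0 y), mul_comm]
    _ ≤ _ := ENNReal.ofReal_le_ofReal
        (sum_prob_mul_trace_exp_le M hB h _ _ _ (isHermitian_deviation h θ k ω))

omit mΩ [MeasurableSpace S] [MeasurableSingletonClass S] in
/-- A bound on the deviation gives the comparison of the observed information matrix with the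
true Hessian. -/
theorem posSemidef_infoMatrix_sub_trueHessian {L ε : ℝ} (hB : M.BΦ ≠ 0)
    (hε : ε = M.BΦ ^ 2 + 4 * M.BΦ ^ 2 * L) {h : ℕ} {θ : Ω → ℕ → EuclideanSpace ℝ (Fin d)}
    {k : ℕ} {ω : Ω}
    (hY : (L • (1 : Matrix (Fin d) (Fin d) ℝ) - deviation M s a h θ k ω).PosSemidef) :
    (infoMatrix ε (episodeLoss M s a h ω) (θ ω) k - (1 - Real.exp (-1)) •
      trueHessian M.BΦ (episodeLoss M s a h ω) (M.θstar h) k).PosSemidef := by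
  set c : ℝ := 1 - Real.exp (-1) with hc
  have hc0 : 0 ≤ c := sub_nonneg.mpr (Real.exp_le_one_iff.mpr (by norm_num))
  have hc1 : 0 ≤ 1 - c := by rw [hc, sub_sub_cancel]; exact (Real.exp_pos _).le
  have hr : (4 * M.BΦ ^ 2) ≠ 0 := by positivity
  have h1 := hY.smul (show 0 ≤ 4 * M.BΦ ^ 2 by positivity)
  have h2 : (∑ ν ∈ Finset.Icc 1 k, c • (M.featureCov h (s ν h ω) (a ν h ω) (M.θstar h) -
      hessian (episodeLoss M s a h ω ν) (M.θstar h))).PosSemidef :=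
    posSemidef_sum _ fun ν _ => (M.posSemidef_featureCov_sub_hessian h _ _ _ _).smul hc0
  have h3 : (((1 - c) * M.BΦ ^ 2) • (1 : Matrix (Fin d) (Fin d) ℝ)).PosSemidef :=
    PosSemidef.one.smul (by positivity)
  -- The difference is `4B² (L - Y_k)`, plus `c` times the sum of covariance minus Hessian, plus the
  -- part `(1 - c) B²` left from the regularizers.
  convert (h1.add h2).add h3 using 1
  have e : (4 * M.BΦ ^ 2) • deviation M s a h θ k ω =
      ∑ ν ∈ Finset.Icc 1 k, (c • M.featureCov h (s ν h ω) (a ν h ω) (M.θstar h) -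
        vecMulVec (gradient (episodeLoss M s a h ω ν) (θ ω (ν - 1))).ofLp
          (gradient (episodeLoss M s a h ω ν) (θ ω (ν - 1))).ofLp) := by
    rw [deviation, Finset.smul_sum]
    refine Finset.sum_congr rfl fun ν _ => ?_
    rw [smul_sub, smul_comm, normalizedCov, smul_inv_smul₀ hr, normalizedOuter, smul_inv_smul₀ hr,
      episodeLoss, M.gradient_loss]
  rw [smul_sub, e, infoMatrix, trueHessian, hε]
  simp only [Finset.sum_sub_distrib, smul_sub, ← Finset.smul_sum]
  module

end Interaction

/-! ### The high-probability comparison -/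

theorem lemma2 {Ω S A : Type*} [MeasurableSpace Ω] [Fintype S] [DecidableEq S]
    [MeasurableSpace S] [MeasurableSingletonClass S] [MeasurableSpace A] {d H K : ℕ}
    (μ : MeasureTheory.Measure Ω) [MeasureTheory.IsProbabilityMeasure μ]
    (M : MNLModel S A d H) (s : ℕ → ℕ → Ω → S) (a : ℕ → ℕ → Ω → A)
    (hsa : IsInteraction M K s a μ)
    (δ : ℝ) (hδ : δ ∈ Set.Ioo (0 : ℝ) 1) (η ε : ℝ) (hε_pos : 0 < ε)
    (hε : ε = M.BΦ ^ 2 + 4 * M.BΦ ^ 2 * Real.log (d / δ))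
    (h : ℕ) (hh : h ∈ Finset.Icc 1 H)
    (θ : Ω → ℕ → EuclideanSpace ℝ (Fin d))
    (hθ : (∀ ω, IsONS η ε K (episodeLoss M s a h ω) (θ ω)) ∨
      (∀ ω, IsProjectedONS η ε M.Bθ K (episodeLoss M s a h ω) (θ ω))) :
    ∃ G : Set Ω, MeasurableSet G ∧ ENNReal.ofReal (1 - δ) ≤ μ G ∧
      ∀ ω ∈ G, ∀ k ∈ Finset.Icc 1 K,
        (infoMatrix ε (episodeLoss M s a h ω) (θ ω) k -
          (1 - Real.exp (-1)) •
            trueHessian M.BΦ (episodeLoss M s a h ω) (M.θstar h) k).PosSemidef := by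
  obtain ⟨hδ0, hδ1⟩ := hδ
  rcases Nat.eq_zero_or_pos d with rfl | hd
  -- In dimension zero the level `d / δ` would be `0`, while all matrices involved coincide.
  · refine ⟨Set.univ, MeasurableSet.univ, ?_, fun ω _ k _ => ?_⟩
    · rw [measure_univ, ← ENNReal.ofReal_one]
      exact ENNReal.ofReal_le_ofReal (by linarith)
    · rw [Subsingleton.elim (infoMatrix _ _ _ _ - _) 0]
      exact Matrix.PosSemidef.zero
  have hB : M.BΦ ≠ 0 := by
    intro h0
    rw [h0] at hε
    norm_num at hε
    exact hε_pos.ne' hε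
  have hd0 : (0 : ℝ) < d := Nat.cast_pos.mpr hd
  have hr0 : 0 < (d : ℝ) / δ := div_pos hd0 hδ0
  have hhI := Finset.mem_Icc.mp hh
  have hs1 : h ∈ Finset.Icc 1 (H + 1) := Finset.mem_Icc.mpr (by omega)
  have hs2 : h + 1 ∈ Finset.Icc 1 (H + 1) := Finset.mem_Icc.mpr (by omega)
  set Z : ℕ → Ω → ENNReal := fun k ω =>
    ENNReal.ofReal (NormedSpace.exp (deviation M s a h θ k ω)).trace with hZ
  have hZm (m : MeasurableSpace Ω) (k : ℕ) (hk : k ≤ K)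
      (hs : ∀ ν ∈ Finset.Icc 1 k, Measurable[m] (s ν h))
      (ha : ∀ ν ∈ Finset.Icc 1 k, Measurable[m] (a ν h))
      (hs' : ∀ ν ∈ Finset.Icc 1 k, Measurable[m] (s ν (h + 1))) :
      (∀ j ≤ k, Measurable[m] fun ω => θ ω j) ∧ ∀ j ≤ k, Measurable[m] (Z j) := by
    have h1 := measurable_estimate (mΩ := m) M hε_pos hθ hk hs ha hs'
    exact ⟨h1, fun j hj => (measurable_trace_exp_of_entries (mΩ := m)
      (measurable_deviation (mΩ := m) hs ha hs' h1 hj)).ennreal_ofReal⟩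
  have hZK := (hZm _ K le_rfl (fun ν hν => hsa.measurable_state ν hν h hs1)
    (fun ν hν => hsa.measurable_action ν hν h hh)
    (fun ν hν => hsa.measurable_state ν hν (h + 1) hs2)).2
  have hset (m : MeasurableSpace Ω) (k : ℕ) (hm : ∀ j ≤ k, Measurable[m] (Z j)) :
      MeasurableSet[m] {ω | ∀ j ≤ k, Z j ω < ENNReal.ofReal (d / δ)} := by
    have : {ω | ∀ j ≤ k, Z j ω < ENNReal.ofReal (d / δ)} =
        ⋂ j ∈ Set.Iic k, {ω | Z j ω < ENNReal.ofReal (d / δ)} := by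
      ext ω; simp
    rw [this]
    exact MeasurableSet.biInter (Set.to_countable _) fun j hj =>
      hm j hj measurableSet_Iio
  -- With level `d / δ` and initial value `d`, the probability of ever reaching the level is at most
  -- `δ`.
  have hmax := mul_measure_compl_add_setLIntegral_le (μ := μ) (r := ENNReal.ofReal (d / δ)) hZK
    (fun k hk => by
      have hIco : ∀ ν ∈ Finset.Icc 1 k, ν ∈ Finset.Ico 1 (k + 1) := fun ν hν => by
        rw [Finset.mem_Icc] at hν
        exact Finset.mem_Ico.mpr (by omega)
      -- The history of episode `k + 1` contains all transitions of the first `k` episodes, hence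
      -- determines `θ ω k`, where the next gradient is evaluated.
      have h1 := hZm (history H s a (k + 1) h) k hk.le
        (fun ν hν => measurable_state_history_of_lt (hIco ν hν) hs1)
        (fun ν hν => measurable_action_history_of_lt (hIco ν hν) hh)
        (fun ν hν => measurable_state_history_of_lt (hIco ν hν) hs2)
      exact setLIntegral_trace_exp_deviation_succ_le hsa hB hh hk h1.1 (hset _ k h1.2)) K le_rfl
  have hGm := hset _ K hZK
  have hZ0 : ∫⁻ ω, Z 0 ω ∂μ = ENNReal.ofReal d := by
    simp [hZ, deviation, Matrix.trace_one]
  refine ⟨_, hGm, ?_, fun ω hω k hk => ?_⟩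
  · have h1 : ENNReal.ofReal (d / δ) * μ {ω | ∀ j ≤ K, Z j ω < ENNReal.ofReal (d / δ)}ᶜ ≤
        ENNReal.ofReal (d / δ) * ENNReal.ofReal δ := by
      rw [← ENNReal.ofReal_mul hr0.le, div_mul_cancel₀ _ hδ0.ne', ← hZ0]
      exact le_self_add.trans hmax
    have h2 := (ENNReal.mul_le_mul_iff_right (ENNReal.ofReal_pos.mpr hr0).ne'
      ENNReal.ofReal_ne_top).mp h1
    rw [ENNReal.ofReal_sub _ hδ0.le, ENNReal.ofReal_one, tsub_le_iff_right,
      ← prob_add_prob_compl (μ := μ) hGm]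
    gcongr
  · refine posSemidef_infoMatrix_sub_trueHessian hB hε
      (posSemidef_log_smul_one_sub (isHermitian_deviation h θ k ω) ?_)
    exact ((ENNReal.ofReal_lt_ofReal_iff hr0).mp (hω k (Finset.mem_Icc.mp hk).2)).le
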